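/- **Notation.** For $x,\xi\in\mathbb{R}^n$ put $M_\xi T_x f(t)=e^{2\pi i\xi\cdot t}f(t-x)$; for $z=(x,\xi)\in\mathbb{R}^{2d}$ and $f$ on $\mathbb{R}^d$ write $\pi(z)f=M_\xi T_xf$. Let $j(z_1,z_2)=(z_2,-z_1)$ on $\mathbb{R}^{2d}$. For $s\ge 0$, the Gelfand–Shilov space $S^s_s(\mathbb{R}^n)$ consists of the smooth functions $f$ on $\mathbb{R}^n$ for which there are $A,B,M>0$ with $$|x^\alpha\partial^\beta f(x)|\le M A^{|\alpha|}B^{|\beta|}(\alpha!)^s(\beta!)^s\qquad(x\in\mathbb{R}^n,\ \alpha,\beta\in\mathbb{N}^n),$$ with its usual inductive limit topology; $(S^s_s)'(\mathbb{R}^n)$ is its dual, and $\langle\sigma,\varphi\rangle$ is the duality bracket, linear in $\sigma\in (S^s_s)'$, antilinear in $\varphi\in S^s_s$, extending $\int f\,\overline{g}$. The cross-Wigner distribution is $$W(f,g)(x,\xi)=\int_{\mathbb{R}^d}f(x+\tfrac t2)\,\overline{g(x-\tfrac t2)}\,e^{-2\pi i t\cdot\xi}\,dt .$$ For $\sigma\in(S^s_s)'(\mathbb{R}^{2d})$,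 the Weyl operator $\sigma^w:S^s_s(\mathbb{R}^d)\to(S^s_s)'(\mathbb{R}^d)$, formally $\sigma^wf(x)=\iint\sigma(\frac{x+y}2,\eta)e^{2\pi i(x-y)\cdot\eta}f(y)\,dy\,d\eta$, is the linear operator given weakly by $\langle\sigma^wf,h\rangle=\langle\sigma,W(h,f)\rangle$ for $f,h\in S^s_s(\mathbb{R}^d)$. For $\Phi\in S^s_s(\mathbb{R}^{2d})$ and $u,v\in\mathbb{R}^{2d}$ the short-time Fourier transform of $\sigma$ is $V_\Phi\sigma(u,v)=\langle\sigma,M_vT_u\Phi\rangle$. **Lemma.** Let $d\ge 0$, $s\ge 1/2$, $g\in S^s_s(\mathbb{R}^d)$ and $\Phi=W(g,g)$. Then $\Phi$ and all $M_vT_u\Phi$ ($u,v\in\mathbb{R}^{2d}$) belong to $S^s_s(\mathbb{R}^{2d})$, all $\pi(z)g$ ($z\in\mathbb{R}^{2d}$) belong to $S^s_s(\mathbb{R}^d)$, and for every $\sigma\in(S^s_s)'(\mathbb{R}^{2d})$ the Weyl operator $\sigma^w$ is well defined (it exists and is unique). Moreover, for all $z,w\in\mathbb{R}^{2d}$, $$|\langle\sigma^w\pi(z)g,\pi(w)g\rangle|=\left|V_\Phi\sigma\left(\frac{z+w}2,\,j(w-z)\right)\right|,$$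 and, for all $u,v\in\mathbb{R}^{2d}$, $$|V_\Phi\sigma(u,v)|=\left|\left\langle\sigma^w\pi\left(u-\tfrac12 j^{-1}(v)\right)g,\ \pi\left(u+\tfrac12 j^{-1}(v)\right)g\right\rangle\right| .$$ -/

import Mathlib

open scoped ContDiff

noncomputable section

/-- The partial derivative `∂^β f` at `x`: the derivative of order `|β|` of `f` at `x`, evaluated on
the standard basis vectors, where `e_j` occurs exactly `β j` times. -/
def partialDeriv {ι : Type} [Fintype ι] [DecidableEq ι] (β : ι → ℕ)
    (f : EuclideanSpace ℝ ι → ℂ) (x : EuclideanSpace ℝ ι) : ℂ :=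
  iteratedFDeriv ℝ (∑ j, β j) f x fun k =>
    EuclideanSpace.single
      ((Fintype.equivFinOfCardEq (α := Σ j, Fin (β j)) (n := ∑ j, β j) (by simp)).symm k).1 (1 : ℝ)

/-- The factorial `α! = ∏ j, (α j)!` of a multi-index. -/
def multiFactorial {ι : Type} [Fintype ι] (α : ι → ℕ) : ℕ := ∏ j, (α j).factorial

/-- `|x^α ∂^β f(x)| ≤ M A^{|α|} B^{|β|} (α!)^r (β!)^s` for all `x` and all multi-indices `α`, `β`. -/
def GelfandShilovBound {ι : Type} [Fintype ι] [DecidableEq ι] (s r A B M : ℝ)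
    (f : EuclideanSpace ℝ ι → ℂ) : Prop :=
  ∀ (α β : ι → ℕ) (x : EuclideanSpace ℝ ι),
    |∏ j, x j ^ α j| * ‖partialDeriv β f x‖ ≤
      M * A ^ (∑ j, α j) * B ^ (∑ j, β j) *
        (multiFactorial α : ℝ) ^ r * (multiFactorial β : ℝ) ^ s

theorem partialDeriv_add {ι : Type} [Fintype ι] [DecidableEq ι] (β : ι → ℕ)
    {f g : EuclideanSpace ℝ ι → ℂ} (hf : ContDiff ℝ ∞ f) (hg : ContDiff ℝ ∞ g)
    (x : EuclideanSpace ℝ ι) :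
    partialDeriv β (f + g) x = partialDeriv β f x + partialDeriv β g x := by
  unfold partialDeriv
  rw [iteratedFDeriv_add_apply (hf.contDiffAt.of_le (by exact_mod_cast le_top))
    (hg.contDiffAt.of_le (by exact_mod_cast le_top))]
  rfl

theorem partialDeriv_smul {ι : Type} [Fintype ι] [DecidableEq ι] (β : ι → ℕ) (c : ℂ)
    {f : EuclideanSpace ℝ ι → ℂ} (hf : ContDiff ℝ ∞ f) (x : EuclideanSpace ℝ ι) :
    partialDeriv β (c • f) x = c * partialDeriv β f x := by
  unfold partialDeriv
  rw [iteratedFDeriv_const_smul_apply (hf.contDiffAt.of_le (by exact_mod_cast le_top))]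
  rfl

theorem norm_partialDeriv_conj {ι : Type} [Fintype ι] [DecidableEq ι] (β : ι → ℕ)
    (f : EuclideanSpace ℝ ι → ℂ) (x : EuclideanSpace ℝ ι) :
    ‖partialDeriv β (fun y => (starRingEnd ℂ) (f y)) x‖ = ‖partialDeriv β f x‖ := by
  unfold partialDeriv
  have h := Complex.conjCLE.iteratedFDeriv_comp_left (𝕜 := ℝ) (f := f) (x := x) (i := ∑ j, β j)
  have h2 : (fun y => (starRingEnd ℂ) (f y)) = Complex.conjCLE ∘ f := rfl
  rw [h2, h]
  simp

theorem GelfandShilovBound.mono {ι : Type} [Fintype ι] [DecidableEq ι]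
    {s r A B M A' B' M' : ℝ} {f : EuclideanSpace ℝ ι → ℂ} (h : GelfandShilovBound s r A B M f)
    (hA : 0 ≤ A) (hB : 0 ≤ B) (hM : 0 ≤ M) (hA' : A ≤ A') (hB' : B ≤ B') (hM' : M ≤ M') :
    GelfandShilovBound s r A' B' M' f := by
  intro α β x
  refine (h α β x).trans ?_
  have hM0 : 0 ≤ M' := hM.trans hM'
  have hA0 : 0 ≤ A' := hA.trans hA'
  have hMA : 0 ≤ M' * A' ^ (∑ j, α j) := by positivity
  have h1 : (0 : ℝ) ≤ (multiFactorial α : ℝ) ^ r := by positivity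
  have h2 : (0 : ℝ) ≤ (multiFactorial β : ℝ) ^ s := by positivity
  gcongr

/-- The Gelfand-Shilov space `S^s_r(ℝ^ι)`, with `s` governing the derivatives and `r` the decay.
(For smooth `f` the bounds contain those that define the Schwartz class.) -/
def gelfandShilov (s r : ℝ) (ι : Type) [Fintype ι] [DecidableEq ι] :
    Submodule ℂ (EuclideanSpace ℝ ι → ℂ) where
  carrier := {f | ContDiff ℝ ∞ f ∧
    ∃ A B M : ℝ, 0 < A ∧ 0 < B ∧ 0 < M ∧ GelfandShilovBound s r A B M f}
  zero_mem' := by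
    refine ⟨contDiff_const, 1, 1, 1, one_pos, one_pos, one_pos, fun α β x => ?_⟩
    have h : partialDeriv β (0 : EuclideanSpace ℝ ι → ℂ) x = 0 := by
      simp [partialDeriv]
    rw [h]
    simp only [norm_zero, mul_zero]
    positivity
  add_mem' := by
    rintro f g ⟨hf, A, B, M, hA, hB, hM, h⟩ ⟨hg, A', B', M', hA', hB', hM', h'⟩
    refine ⟨hf.add hg, max A A', max B B', M + M', by positivity, by positivity, by positivity, ?_⟩
    intro α β x
    have e1 := h.mono hA.le hB.le hM.le (le_max_left A A') (le_max_left B B') le_rfl α β x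
    have e2 := h'.mono hA'.le hB'.le hM'.le (le_max_right A A') (le_max_right B B') le_rfl α β x
    rw [partialDeriv_add β hf hg]
    calc _ ≤ |∏ j, x j ^ α j| * (‖partialDeriv β f x‖ + ‖partialDeriv β g x‖) := by
            gcongr
            exact norm_add_le _ _
      _ = |∏ j, x j ^ α j| * ‖partialDeriv β f x‖ + |∏ j, x j ^ α j| * ‖partialDeriv β g x‖ := by
            ring
      _ ≤ _ := add_le_add e1 e2
      _ = _ := by ring
  smul_mem' := by
    rintro c f ⟨hf, A, B, M, hA, hB, hM, h⟩
    refine ⟨hf.const_smul c, A, B, (‖c‖ + 1) * M, hA, hB, by positivity, ?_⟩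
    intro α β x
    rw [partialDeriv_smul β c hf, norm_mul]
    have h0 : 0 ≤ |∏ j, x j ^ α j| * ‖partialDeriv β f x‖ := by positivity
    calc _ = ‖c‖ * (|∏ j, x j ^ α j| * ‖partialDeriv β f x‖) := by ring
      _ ≤ (‖c‖ + 1) * (|∏ j, x j ^ α j| * ‖partialDeriv β f x‖) := by
            gcongr
            linarith
      _ ≤ (‖c‖ + 1) * _ := mul_le_mul_of_nonneg_left (h α β x) (by positivity)
      _ = _ := by ring

/-- Complex conjugation on `S^s_r`. -/
def gelfandShilovConj {s r : ℝ} {ι : Type} [Fintype ι] [DecidableEq ι]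
    (φ : gelfandShilov s r ι) : gelfandShilov s r ι :=
  ⟨fun x => (starRingEnd ℂ) ((φ : EuclideanSpace ℝ ι → ℂ) x), by
    obtain ⟨f, hf, A, B, M, hA, hB, hM, h⟩ := φ
    refine ⟨Complex.conjCLE.contDiff.comp hf, A, B, M, hA, hB, hM, fun α β x => ?_⟩
    rw [norm_partialDeriv_conj]
    exact h α β x⟩

/-- The space `(S^s_r)'(ℝ^ι)` of tempered ultra-distributions: the continuous linear functionals on
`S^s_r(ℝ^ι)`. Here `S^s_r` has its usual topology, the (locally convex) inductive limit over
`A, B > 0` of the normed spaces of functions with finite norm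
`sup |x^α ∂^β f(x)| / (A^{|α|} B^{|β|} (α!)^r (β!)^s)`; a linear functional on it is continuous if
and only if it is bounded on each of these normed spaces. -/
def ultraDistribution (s r : ℝ) (ι : Type) [Fintype ι] [DecidableEq ι] :
    Submodule ℂ (Module.Dual ℂ (gelfandShilov s r ι)) where
  carrier := {σ | ∀ A B : ℝ, 0 < A → 0 < B → ∃ C : ℝ, ∀ (φ : gelfandShilov s r ι) (M : ℝ),
    GelfandShilovBound s r A B M (φ : EuclideanSpace ℝ ι → ℂ) → ‖σ φ‖ ≤ C * M}
  zero_mem' := fun A B _ _ => ⟨0, fun φ M _ => by simp⟩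
  add_mem' := by
    intro σ τ hσ hτ A B hA hB
    obtain ⟨C, hC⟩ := hσ A B hA hB
    obtain ⟨D, hD⟩ := hτ A B hA hB
    refine ⟨C + D, fun φ M h => ?_⟩
    rw [LinearMap.add_apply, add_mul]
    exact (norm_add_le _ _).trans (add_le_add (hC φ M h) (hD φ M h))
  smul_mem' := by
    intro c σ hσ A B hA hB
    obtain ⟨C, hC⟩ := hσ A B hA hB
    refine ⟨‖c‖ * C, fun φ M h => ?_⟩
    rw [LinearMap.smul_apply, norm_smul, mul_assoc]
    exact mul_le_mul_of_nonneg_left (hC φ M h) (norm_nonneg c)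

/-- The duality bracket `⟨σ, φ⟩` of `(S^s_r)' × S^s_r`, linear in `σ` and antilinear in `φ`; it
extends the inner product `∫ f(t) conj(g(t)) dt`. -/
def ultraBracket {s r : ℝ} {ι : Type} [Fintype ι] [DecidableEq ι]
    (σ : ultraDistribution s r ι) (φ : gelfandShilov s r ι) : ℂ :=
  (σ : Module.Dual ℂ (gelfandShilov s r ι)) (gelfandShilovConj φ)

/-- The time-frequency shift `M_ξ T_x f (t) = e^{2 π i ξ·t} f(t - x)`. -/
def timeFreqShift {ι : Type} [Fintype ι] (x ξ : EuclideanSpace ℝ ι)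
    (f : EuclideanSpace ℝ ι → ℂ) : EuclideanSpace ℝ ι → ℂ :=
  fun t => Complex.exp (2 * Real.pi * Complex.I * (inner ℝ ξ t : ℝ)) * f (t - x)

/-- The short-time Fourier transform `V_Φ σ (x, ξ) = ⟨σ, M_ξ T_x Φ⟩` of an ultra-distribution, for a
window `Φ` all of whose time-frequency shifts are test functions. -/
def stft {s r : ℝ} {ι : Type} [Fintype ι] [DecidableEq ι] (σ : ultraDistribution s r ι)
    (Φ : EuclideanSpace ℝ ι → ℂ) (hΦ : ∀ x ξ, timeFreqShift x ξ Φ ∈ gelfandShilov s r ι)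
    (x ξ : EuclideanSpace ℝ ι) : ℂ :=
  ultraBracket σ ⟨timeFreqShift x ξ Φ, hΦ x ξ⟩

/-- `ℝ^{2d}`, written as `ℝ^d × ℝ^d` through its index set. -/
abbrev PhaseSpace (d : ℕ) : Type := EuclideanSpace ℝ (Fin d ⊕ Fin d)

/-- The component `x` of `z = (x, ξ)`. -/
def phasePos {d : ℕ} (z : PhaseSpace d) : EuclideanSpace ℝ (Fin d) :=
  WithLp.toLp 2 fun i => z (Sum.inl i)

/-- The component `ξ` of `z = (x, ξ)`. -/
def phaseFreq {d : ℕ} (z : PhaseSpace d) : EuclideanSpace ℝ (Fin d) :=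
  WithLp.toLp 2 fun i => z (Sum.inr i)

/-- The operator `π(z) = M_ξ T_x` for `z = (x, ξ)`. -/
def phaseShift {d : ℕ} (z : PhaseSpace d) (f : EuclideanSpace ℝ (Fin d) → ℂ) :
    EuclideanSpace ℝ (Fin d) → ℂ :=
  timeFreqShift (phasePos z) (phaseFreq z) f

/-- The rotation `j(z₁, z₂) = (z₂, -z₁)` of `ℝ^{2d}`. -/
def phaseRotation (d : ℕ) : PhaseSpace d ≃ₗ[ℝ] PhaseSpace d where
  toFun z := WithLp.toLp 2 (Sum.elim (fun i => z (Sum.inr i)) (fun i => -z (Sum.inl i)))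
  invFun z := WithLp.toLp 2 (Sum.elim (fun i => -z (Sum.inr i)) (fun i => z (Sum.inl i)))
  map_add' z w := by
    ext i
    rcases i with i | i <;> simp [add_comm]
  map_smul' c z := by
    ext i
    rcases i with i | i <;> simp
  left_inv z := by
    ext i
    rcases i with i | i <;> simp
  right_inv z := by
    ext i
    rcases i with i | i <;> simp

/-- The cross-Wigner distribution
`W(f, g)(x, ξ) = ∫ f(x + t/2) conj(g(x - t/2)) e^{-2 π i t·ξ} dt`. -/
def crossWigner {d : ℕ} (f g : EuclideanSpace ℝ (Fin d) → ℂ) (z : PhaseSpace d) : ℂ :=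
  ∫ t : EuclideanSpace ℝ (Fin d),
    f (phasePos z + (1 / 2 : ℝ) • t) * (starRingEnd ℂ) (g (phasePos z - (1 / 2 : ℝ) • t)) *
      Complex.exp (-(2 * Real.pi * Complex.I * (inner ℝ t (phaseFreq z) : ℝ)))

/-- `T` is the Weyl operator `σ^w : S^s_s(ℝ^d) → (S^s_s)'(ℝ^d)` with symbol the ultra-distribution
`σ` on `ℝ^{2d}`. The formula
`σ^w f(x) = ∫∫ σ((x+y)/2, η) e^{2πi(x-y)·η} f(y) dy dη` is read in the weak sense: paired with a test
function `h`, and with the variables `(x+y)/2`, `t = x - y`, it says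
`⟨σ^w f, h⟩ = ⟨σ, W(h, f)⟩`. -/
def IsWeylOperator {s : ℝ} {d : ℕ} (σ : ultraDistribution s s (Fin d ⊕ Fin d))
    (T : gelfandShilov s s (Fin d) →ₗ[ℂ] ultraDistribution s s (Fin d)) : Prop :=
  ∀ f h : gelfandShilov s s (Fin d),
    ∃ hW : crossWigner (h : EuclideanSpace ℝ (Fin d) → ℂ) (f : EuclideanSpace ℝ (Fin d) → ℂ) ∈
        gelfandShilov s s (Fin d ⊕ Fin d),
      ultraBracket (T f) h = ultraBracket σ ⟨_, hW⟩

end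

/-! The identity is the covariance of the Wigner distribution: W(π(w)g, π(z)g) = c · M_{j(w-z)}
T_{(z+w)/2} W(g,g) with |c| = 1 (`crossWigner_phaseShift`). Put into ⟨σ^w f, h⟩ = ⟨σ, W(h,f)⟩, it
gives the first formula, and the second one inverts (z,w) ↦ ((z+w)/2, j(w-z)).

The analytic work is to show that these brackets make sense: S^s_s must be stable under
time-frequency shifts and under W, with bounds uniform enough to make σ^w f continuous. The
monomials x^α ∂^β are awkward here, since neither operation respects their order. They are replaced
by arbitrary words in the x_j and ∂_j: f satisfies `WordBound` if every word of length n maps f to a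
function bounded by M C^n (n!)^s. For s ≥ 1/2 this is equivalent to the Gelfand–Shilov bounds. The
substantial direction is normal ordering (`norm_wordOp_normalForm_le`), where s ≥ 1/2 is what lets
the commutators [∂_j, x_j] = 1 be absorbed.

On words both operations are transparent. A time-frequency shift changes each letter by a scalar
(`letterOp_timeFreqShift`). A letter on ℝ^{2d} applied to W(p,q) gives a combination of W(l'p,q) and
W(p,l'q) for one letter l' on ℝ^d (`exists_letterOp_crossWigner`). A word of length n therefore
expands into 2^n terms W(w₁p, w₂q) with |w₁| + |w₂| = n, each bounded through d+1 further letters on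
either argument. All constants depend only on the parameters of the bounds, so the same estimates
give stability and continuity. -/

noncomputable section


/-! ### Words in the coordinates and the partial derivatives -/

/-- The generators of the Weyl algebra: the coordinates and the partial derivatives. -/
inductive WeylLetter (ι : Type) : Type
  | pos (j : ι) : WeylLetter ι
  | deriv (j : ι) : WeylLetter ι

/-- The action of a generator of the Weyl algebra on functions. -/
def letterOp {ι : Type} [Fintype ι] [DecidableEq ι] :
    WeylLetter ι → (EuclideanSpace ℝ ι → ℂ) → EuclideanSpace ℝ ι → ℂ
  | .pos j, f => fun x => (x j : ℂ) * f x
  | .deriv j, f => fun x => fderiv ℝ f x (EuclideanSpace.single j 1)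

/-- The action of a word in the generators; the head of the list acts first. -/
def wordOp {ι : Type} [Fintype ι] [DecidableEq ι] :
    List (WeylLetter ι) → (EuclideanSpace ℝ ι → ℂ) → EuclideanSpace ℝ ι → ℂ
  | [], f => f
  | l :: w, f => wordOp w (letterOp l f)

section WordOp

variable {ι : Type} [Fintype ι] [DecidableEq ι] {f g : EuclideanSpace ℝ ι → ℂ}

theorem wordOp_append (w w' : List (WeylLetter ι)) (f : EuclideanSpace ℝ ι → ℂ) :
    wordOp (w ++ w') f = wordOp w' (wordOp w f) := by
  induction w generalizing f with
  | nil => rfl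
  | cons l w ih => exact ih _

omit [DecidableEq ι] in
theorem contDiff_coord (j : ι) : ContDiff ℝ ∞ fun x : EuclideanSpace ℝ ι => (x j : ℂ) :=
  (Complex.ofRealCLM.comp (EuclideanSpace.proj (𝕜 := ℝ) j)).contDiff

theorem contDiff_letterOp (hf : ContDiff ℝ ∞ f) (l : WeylLetter ι) :
    ContDiff ℝ ∞ (letterOp l f) := by
  cases l with
  | pos j => exact (contDiff_coord j).mul hf
  | deriv j => exact (hf.fderiv_right (m := ∞) (by simp)).clm_apply contDiff_const

theorem contDiff_wordOp (hf : ContDiff ℝ ∞ f) (w : List (WeylLetter ι)) :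
    ContDiff ℝ ∞ (wordOp w f) := by
  induction w generalizing f with
  | nil => exact hf
  | cons l w ih => exact ih (contDiff_letterOp hf l)

theorem ContDiff.differentiable_of_infty {E F : Type*} [NormedAddCommGroup E] [NormedSpace ℝ E]
    [NormedAddCommGroup F] [NormedSpace ℝ F] {f : E → F} (hf : ContDiff ℝ ∞ f) :
    Differentiable ℝ f :=
  hf.differentiable (by simp)

theorem letterOp_add (hf : ContDiff ℝ ∞ f) (hg : ContDiff ℝ ∞ g) (l : WeylLetter ι) :
    letterOp l (f + g) = letterOp l f + letterOp l g := by
  funext x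
  cases l with
  | pos j => simp [letterOp, mul_add]
  | deriv j =>
    simp [letterOp, fderiv_add hf.differentiable_of_infty.differentiableAt
      hg.differentiable_of_infty.differentiableAt]

theorem letterOp_smul (hf : ContDiff ℝ ∞ f) (c : ℂ) (l : WeylLetter ι) :
    letterOp l (c • f) = c • letterOp l f := by
  funext x
  cases l with
  | pos j => simp [letterOp]; ring
  | deriv j =>
    simp [letterOp, fderiv_const_smul hf.differentiable_of_infty.differentiableAt]

theorem wordOp_add (hf : ContDiff ℝ ∞ f) (hg : ContDiff ℝ ∞ g) (w : List (WeylLetter ι)) :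
    wordOp w (f + g) = wordOp w f + wordOp w g := by
  induction w generalizing f g with
  | nil => rfl
  | cons l w ih =>
    simp only [wordOp, letterOp_add hf hg]
    exact ih (contDiff_letterOp hf l) (contDiff_letterOp hg l)

theorem wordOp_smul (hf : ContDiff ℝ ∞ f) (c : ℂ) (w : List (WeylLetter ι)) :
    wordOp w (c • f) = c • wordOp w f := by
  induction w generalizing f with
  | nil => rfl
  | cons l w ih =>
    simp only [wordOp, letterOp_smul hf]
    exact ih (contDiff_letterOp hf l)

theorem wordOp_add_smul (hf : ContDiff ℝ ∞ f) (hg : ContDiff ℝ ∞ g) (c : ℂ)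
    (w : List (WeylLetter ι)) : wordOp w (f + c • g) = wordOp w f + c • wordOp w g := by
  have hcg : ContDiff ℝ ∞ (c • g) := hg.const_smul c
  rw [wordOp_add hf hcg, wordOp_smul hg]

/-- Iterated partial derivatives along a list of coordinates, the head acting first. -/
abbrev derivList (v : List ι) (f : EuclideanSpace ℝ ι → ℂ) : EuclideanSpace ℝ ι → ℂ :=
  wordOp (v.map WeylLetter.deriv) f

theorem letterOp_deriv_comm (hf : ContDiff ℝ ∞ f) (i j : ι) :
    letterOp (.deriv i) (letterOp (.deriv j) f) = letterOp (.deriv j) (letterOp (.deriv i) f) := by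
  funext x
  have hd : DifferentiableAt ℝ (fderiv ℝ f) x :=
    (hf.fderiv_right (m := ∞) (by simp)).differentiable_of_infty.differentiableAt
  have key : ∀ a b : ι, letterOp (.deriv a) (letterOp (.deriv b) f) x =
      fderiv ℝ (fderiv ℝ f) x (EuclideanSpace.single a 1) (EuclideanSpace.single b 1) := by
    intro a b
    simp only [letterOp]
    rw [fderiv_clm_apply hd (differentiableAt_const _)]
    simp
  rw [key, key]
  exact (hf.contDiffAt.isSymmSndFDerivAt (by
    rw [minSmoothness_of_isRCLikeNormedField]
    exact WithTop.coe_le_coe.2 (le_top : (2 : ℕ∞) ≤ ⊤))).eq _ _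

theorem derivList_perm {v v' : List ι} (h : v.Perm v') (hf : ContDiff ℝ ∞ f) :
    derivList v f = derivList v' f := by
  induction h generalizing f with
  | nil => rfl
  | cons a _ ih => exact ih (contDiff_letterOp hf _)
  | swap a b v =>
    simp only [derivList, List.map_cons, wordOp]
    rw [letterOp_deriv_comm hf]
  | trans _ _ ih₁ ih₂ => exact (ih₁ hf).trans (ih₂ hf)

/-- Slot 0 of the iterated derivative is the outermost differentiation, whereas the head of a word
acts first; hence the reversal. -/
theorem iteratedFDeriv_eq_derivList (hf : ContDiff ℝ ∞ f) {m : ℕ} (v : Fin m → ι)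
    (x : EuclideanSpace ℝ ι) :
    iteratedFDeriv ℝ m f x (fun k => EuclideanSpace.single (v k) 1) =
      derivList (List.ofFn v).reverse f x := by
  induction m generalizing x with
  | zero => simp [derivList, wordOp]
  | succ m ih =>
    rw [iteratedFDeriv_succ_apply_left, List.ofFn_succ, List.reverse_cons, derivList,
      List.map_append, wordOp_append]
    have hd : DifferentiableAt ℝ (iteratedFDeriv ℝ m f) x :=
      hf.differentiable_iteratedFDeriv (by exact_mod_cast WithTop.coe_lt_top m) x
    have h2 : derivList (List.ofFn fun i : Fin m => v i.succ).reverse f =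
        fun y => iteratedFDeriv ℝ m f y (fun k => EuclideanSpace.single (v k.succ) 1) := by
      funext y
      exact (ih (fun k => v k.succ) y).symm
    change _ = letterOp (.deriv (v 0)) (derivList (List.ofFn fun i : Fin m => v i.succ).reverse f) x
    rw [h2]
    simp only [letterOp]
    have h3 : HasFDerivAt (fun y => iteratedFDeriv ℝ m f y
        (fun k => EuclideanSpace.single (v k.succ) 1))
        ((ContinuousMultilinearMap.apply ℝ (fun _ : Fin m => EuclideanSpace ℝ ι) ℂ
          (fun k => EuclideanSpace.single (v k.succ) 1)).comp
            (fderiv ℝ (iteratedFDeriv ℝ m f) x)) x :=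
      (ContinuousMultilinearMap.apply ℝ (fun _ : Fin m => EuclideanSpace ℝ ι) ℂ
          (fun k => EuclideanSpace.single (v k.succ) 1)).hasFDerivAt.comp x hd.hasFDerivAt
    rw [h3.fderiv]
    rfl

/-- Partial derivatives of a smooth function commute, so the arbitrary enumeration inside
`partialDeriv` is irrelevant and only multiplicities count. -/
theorem partialDeriv_eq_derivList (hf : ContDiff ℝ ∞ f) (β : ι → ℕ) {v : List ι}
    (hv : ∀ j, v.count j = β j) : partialDeriv β f = derivList v f := by
  funext x
  unfold partialDeriv
  rw [iteratedFDeriv_eq_derivList hf]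
  refine congrFun (derivList_perm ?_ hf) x
  rw [List.perm_iff_count]
  intro j
  rw [hv, List.count_reverse, ← Multiset.coe_count, ← List.map_id (List.ofFn _)]
  set e := Fintype.equivFinOfCardEq (α := Σ j, Fin (β j)) (n := ∑ j, β j) (by simp)
  -- As a multiset, the enumeration is the image of Σ j, Fin (β j) under the first projection, whose
  -- fibre over j has β j elements.
  have h1 : ((List.map id (List.ofFn fun k => (e.symm k).1) : List ι) : Multiset ι) =
      (Finset.univ : Finset (Σ j, Fin (β j))).val.map Sigma.fst := by
    have h0 : ((List.finRange (∑ j, β j) : List _) : Multiset (Fin (∑ j, β j))) =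
      Finset.univ.val := rfl
    rw [List.map_id, List.ofFn_eq_map, ← Multiset.map_coe, h0,
      ← Multiset.map_univ_val_equiv e, Multiset.map_map]
    simp
  rw [h1, Multiset.count_map]
  change (Finset.univ.filter fun p : (Σ j, Fin (β j)) => j = p.1).card = β j
  have : (Finset.univ.filter fun p : (Σ j, Fin (β j)) => j = p.1) =
      (Finset.univ : Finset (Fin (β j))).map ⟨Sigma.mk j, sigma_mk_injective⟩ := by
    ext ⟨i, k⟩
    simp only [Finset.mem_filter, Finset.mem_univ, true_and, Finset.mem_map,
      Function.Embedding.coeFn_mk]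
    constructor
    · rintro rfl
      exact ⟨k, rfl⟩
    · rintro ⟨a, h⟩
      exact congrArg Sigma.fst h
  rw [this]
  simp

/-- A list in which each `j` occurs exactly `β j` times. -/
theorem exists_list_count (β : ι → ℕ) :
    ∃ v : List ι, v.length = ∑ j, β j ∧ ∀ j, v.count j = β j := by
  refine ⟨(∑ j, Multiset.replicate (β j) j).toList, by simp, fun j => ?_⟩
  rw [← Multiset.coe_count, Multiset.coe_toList, Multiset.count_sum']
  simp [Multiset.count_replicate]

theorem contDiff_partialDeriv (hf : ContDiff ℝ ∞ f) (β : ι → ℕ) :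
    ContDiff ℝ ∞ (partialDeriv β f) := by
  obtain ⟨v, -, hv⟩ := exists_list_count β
  rw [partialDeriv_eq_derivList hf β hv]
  exact contDiff_wordOp hf _

theorem partialDeriv_zero_eq (hf : ContDiff ℝ ∞ f) : partialDeriv (0 : ι → ℕ) f = f :=
  partialDeriv_eq_derivList hf 0 (v := []) (by simp)

theorem letterOp_deriv_partialDeriv (hf : ContDiff ℝ ∞ f) (β : ι → ℕ) (j : ι) :
    letterOp (.deriv j) (partialDeriv β f) = partialDeriv (β + Pi.single j 1) f := by
  obtain ⟨v, -, hv⟩ := exists_list_count β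
  rw [partialDeriv_eq_derivList hf β hv, partialDeriv_eq_derivList hf (v := v ++ [j])]
  · simp [derivList, wordOp_append, wordOp]
  · intro i
    simp only [List.count_append, hv, Pi.add_apply, Pi.single_apply]
    congr 1
    by_cases h : i = j
    · subst h
      simp
    · rw [if_neg h, List.count_eq_zero]
      simpa using h

end WordOp


/-! ### Normal ordering: word bounds against Gelfand–Shilov bounds -/

/-- `f` is smooth and `‖w f‖ ≤ M C^n (n!)^s` for all words `w` of length `n` in the coordinates and
the partial derivatives. -/
def WordBound {ι : Type} [Fintype ι] [DecidableEq ι] (s C M : ℝ)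
    (f : EuclideanSpace ℝ ι → ℂ) : Prop :=
  ContDiff ℝ ∞ f ∧ ∀ (w : List (WeylLetter ι)) (x : EuclideanSpace ℝ ι),
    ‖wordOp w f x‖ ≤ M * (C ^ w.length * (w.length.factorial : ℝ) ^ s)

/-- The function `x^α ∂^β f(x)`. -/
def normalForm {ι : Type} [Fintype ι] [DecidableEq ι] (α β : ι → ℕ)
    (f : EuclideanSpace ℝ ι → ℂ) (x : EuclideanSpace ℝ ι) : ℂ :=
  (∏ j, (x j : ℂ) ^ α j) * partialDeriv β f x

section NormalOrdering

variable {ι : Type} [Fintype ι] [DecidableEq ι] {f : EuclideanSpace ℝ ι → ℂ}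

omit [DecidableEq ι] in
theorem contDiff_monomial (α : ι → ℕ) :
    ContDiff ℝ ∞ fun x : EuclideanSpace ℝ ι => ∏ j, (x j : ℂ) ^ α j :=
  contDiff_prod fun j _ => (contDiff_coord j).pow _

theorem contDiff_normalForm (hf : ContDiff ℝ ∞ f) (α β : ι → ℕ) :
    ContDiff ℝ ∞ (normalForm α β f) :=
  (contDiff_monomial α).mul (contDiff_partialDeriv hf β)

theorem norm_normalForm (α β : ι → ℕ) (f : EuclideanSpace ℝ ι → ℂ) (x : EuclideanSpace ℝ ι) :
    ‖normalForm α β f x‖ = |∏ j, x j ^ α j| * ‖partialDeriv β f x‖ := by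
  rw [normalForm, norm_mul]
  congr 1
  rw [← Real.norm_eq_abs, ← Complex.norm_real]
  push_cast
  rfl

theorem letterOp_pos_normalForm (α β : ι → ℕ) (f : EuclideanSpace ℝ ι → ℂ) (j : ι) :
    letterOp (.pos j) (normalForm α β f) = normalForm (α + Pi.single j 1) β f := by
  funext x
  simp only [letterOp, normalForm, Pi.add_apply, pow_add, Finset.prod_mul_distrib]
  rw [Finset.prod_eq_single j (f := fun i => (x i : ℂ) ^ (Pi.single j 1 : ι → ℕ) i)]
  · simp
    ring
  · intro i _ hi
    simp [Pi.single_eq_of_ne hi]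
  · simp

/-- The truncated subtraction is harmless: where it truncates, the coefficient α j is zero. -/
theorem fderiv_monomial_single (α : ι → ℕ) (j : ι) (x : EuclideanSpace ℝ ι) :
    fderiv ℝ (fun x : EuclideanSpace ℝ ι => ∏ i, (x i : ℂ) ^ α i) x (EuclideanSpace.single j 1) =
      α j * ∏ i, (x i : ℂ) ^ (α - Pi.single j 1 : ι → ℕ) i := by
  have hc : ∀ i, HasFDerivAt (fun x : EuclideanSpace ℝ ι => (x i : ℂ))
      (Complex.ofRealCLM.comp (EuclideanSpace.proj (𝕜 := ℝ) i)) x := fun i =>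
    (Complex.ofRealCLM.comp (EuclideanSpace.proj (𝕜 := ℝ) i)).hasFDerivAt
  have h := HasFDerivAt.finsetProd (u := Finset.univ) fun i _ => (hc i).pow (α i)
  rw [h.fderiv, sum_apply, Finset.sum_eq_single j]
  · rw [← Finset.mul_prod_erase _ _ (Finset.mem_univ j)]
    have h2 : ∏ i ∈ Finset.univ.erase j, (x i : ℂ) ^ (α - Pi.single j 1 : ι → ℕ) i =
        ∏ i ∈ Finset.univ.erase j, (x i : ℂ) ^ α i :=
      Finset.prod_congr rfl fun i hi => by
        simp [Pi.single_eq_of_ne (Finset.ne_of_mem_erase hi)]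
    rw [h2]
    simp
    ring
  · intro i _ hi
    simp [hi]
  · simp

theorem letterOp_deriv_normalForm (hf : ContDiff ℝ ∞ f) (α β : ι → ℕ) (j : ι) :
    letterOp (.deriv j) (normalForm α β f) =
      normalForm α (β + Pi.single j 1) f + (α j : ℂ) • normalForm (α - Pi.single j 1) β f := by
  funext x
  have h1 : normalForm α β f = (fun x => ∏ i, (x i : ℂ) ^ α i) * partialDeriv β f := rfl
  have h2 := congrFun (letterOp_deriv_partialDeriv hf β j) x
  simp only [letterOp] at h2 ⊢
  rw [h1, fderiv_mul (contDiff_monomial α).differentiable_of_infty.differentiableAt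
    (contDiff_partialDeriv hf β).differentiable_of_infty.differentiableAt]
  simp only [add_apply, smul_apply, Pi.add_apply,
    Pi.smul_apply, smul_eq_mul, fderiv_monomial_single, h2, normalForm]
  ring

/-- Each letter costs a factor 2Q. A coordinate raises the degree |α| + |β| by one. A derivative
gives one term of degree one higher and a commutator term of degree one lower with coefficient α j ≤
n ≤ Q², which pays for the two missing degrees. The cap n on the total degree keeps α j ≤ n
throughout the induction. -/
theorem norm_wordOp_normalForm_le (hf : ContDiff ℝ ∞ f) {n : ℕ} {Q M : ℝ} (hQ : 1 ≤ Q)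
    (hnQ : n ≤ Q ^ 2) (hM : 0 ≤ M)
    (h : ∀ (α β : ι → ℕ) (x : EuclideanSpace ℝ ι), ∑ j, α j + ∑ j, β j ≤ n →
      ‖normalForm α β f x‖ ≤ M * Q ^ (∑ j, α j + ∑ j, β j))
    (w : List (WeylLetter ι)) (α β : ι → ℕ) (x : EuclideanSpace ℝ ι)
    (hw : w.length + (∑ j, α j + ∑ j, β j) ≤ n) :
    ‖wordOp w (normalForm α β f) x‖ ≤
      M * 2 ^ w.length * Q ^ (w.length + (∑ j, α j + ∑ j, β j)) := by
  have hQ0 : 0 ≤ Q := by linarith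
  induction w generalizing α β with
  | nil => simpa [wordOp] using h α β x (by simpa using hw)
  | cons l w ih =>
    have hs : ∀ (γ : ι → ℕ) (j : ι), ∑ i, (γ + Pi.single j 1 : ι → ℕ) i = ∑ i, γ i + 1 := by
      intro γ j
      simp [Finset.sum_add_distrib]
    have hp : (0 : ℝ) ≤ 2 ^ w.length := by positivity
    simp only [List.length_cons] at hw ⊢
    cases l with
    | pos j =>
      rw [wordOp, letterOp_pos_normalForm]
      refine (ih _ _ (by rw [hs]; omega)).trans ?_
      rw [hs, show w.length + (∑ i, α i + 1 + ∑ i, β i) =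
        w.length + 1 + (∑ i, α i + ∑ i, β i) by ring]
      gcongr
      · norm_num
      · omega
    | deriv j =>
      rw [wordOp, letterOp_deriv_normalForm hf,
        wordOp_add_smul (contDiff_normalForm hf _ _) (contDiff_normalForm hf _ _)]
      have e1 := ih α (β + Pi.single j 1) (by rw [hs]; omega)
      rw [hs, show w.length + (∑ i, α i + (∑ i, β i + 1)) =
        w.length + 1 + (∑ i, α i + ∑ i, β i) by ring] at e1
      have e2 : ‖(α j : ℂ) * wordOp w (normalForm (α - Pi.single j 1) β f) x‖ ≤
          M * 2 ^ w.length * Q ^ (w.length + 1 + (∑ i, α i + ∑ i, β i)) := by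
        rcases Nat.eq_zero_or_pos (α j) with h0 | h0
        · simp only [h0, Nat.cast_zero, zero_mul, norm_zero]
          positivity
        · have hα : α = (α - Pi.single j 1) + Pi.single j 1 := by
            funext i
            by_cases hi : i = j
            · subst hi
              simp
              omega
            · simp [Pi.single_eq_of_ne hi]
          have hα' : ∑ i, α i = ∑ i, (α - Pi.single j 1 : ι → ℕ) i + 1 := by
            conv_lhs => rw [hα]
            exact hs _ _
          have hαj : α j ≤ ∑ i, α i := Finset.single_le_sum (fun _ _ => Nat.zero_le _)
            (Finset.mem_univ j)
          have hc : (α j : ℝ) ≤ Q ^ 2 := le_trans (by exact_mod_cast by omega) hnQ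
          have e3 := ih (α - Pi.single j 1) β (by omega)
          rw [norm_mul, Complex.norm_natCast]
          calc _ ≤ Q ^ 2 * (M * 2 ^ w.length *
                Q ^ (w.length + (∑ i, (α - Pi.single j 1 : ι → ℕ) i + ∑ i, β i))) := by gcongr
            _ = _ := by
              rw [hα']
              ring
      calc _ ≤ _ := norm_add_le _ _
        _ ≤ _ := add_le_add e1 e2
        _ = _ := by ring

end NormalOrdering

theorem multiFactorial_le_pow {ι : Type} [Fintype ι] (α : ι → ℕ) {n : ℕ} (h : ∑ j, α j ≤ n) :
    multiFactorial α ≤ n ^ ∑ j, α j := by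
  rw [multiFactorial, ← Finset.prod_pow_eq_pow_sum]
  refine Finset.prod_le_prod' fun j hj => (Nat.factorial_le_pow (α j)).trans ?_
  exact Nat.pow_le_pow_left ((Finset.single_le_sum (fun _ _ => Nat.zero_le _) hj).trans h) _

theorem nat_pow_self_le_exp_mul_factorial (n : ℕ) : (n : ℝ) ^ n ≤ Real.exp 1 ^ n * n.factorial := by
  have h := Real.pow_div_factorial_le_exp n n.cast_nonneg n
  rw [div_le_iff₀ (by positivity)] at h
  rwa [← Real.exp_nat_mul, mul_one]

theorem GelfandShilovBound.nonneg {ι : Type} [Fintype ι] [DecidableEq ι] {s r A B M : ℝ}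
    {f : EuclideanSpace ℝ ι → ℂ} (h : GelfandShilovBound s r A B M f) : 0 ≤ M := by
  have h0 := h 0 0 0
  simp only [Pi.zero_apply, pow_zero, Finset.prod_const_one, abs_one, one_mul,
    Finset.sum_const_zero, mul_one, multiFactorial, Nat.factorial_zero, Nat.cast_one,
    Real.one_rpow] at h0
  exact (norm_nonneg _).trans h0

/-- The bounds that define the Gelfand-Shilov space `S^s_s`, `s ≥ 1/2`, control all words in the
coordinates and the partial derivatives. -/
theorem exists_wordBound_of_gelfandShilovBound {ι : Type} [Fintype ι] [DecidableEq ι] {s : ℝ}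
    (hs : 1 / 2 ≤ s) (A B : ℝ) (hA : 0 < A) (hB : 0 < B) :
    ∃ C : ℝ, 1 ≤ C ∧ ∀ (f : EuclideanSpace ℝ ι → ℂ) (M : ℝ), ContDiff ℝ ∞ f →
      GelfandShilovBound s s A B M f → WordBound s C M f := by
  set K := max 1 (max A B) with hK
  have hK1 : 1 ≤ K := le_max_left _ _
  have hs0 : 0 ≤ s := by linarith
  have he : (1 : ℝ) ≤ Real.exp 1 ^ s := Real.one_le_rpow (Real.one_le_exp zero_le_one) hs0
  -- The 2 comes from the splitting in normal ordering, K from A and B, and e^s from n^n ≤ e^n n!.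
  refine ⟨2 * K * Real.exp 1 ^ s, by nlinarith, fun f M hf h => ⟨hf, fun w x => ?_⟩⟩
  have hM := h.nonneg
  set n := w.length with hn
  -- The empty word is separate because Q = K n^s ≥ 1 needs n ≥ 1.
  rcases Nat.eq_zero_or_pos n with h0 | h0
  · have hw : w = [] := List.length_eq_zero_iff.1 (hn ▸ h0)
    subst hw
    have h1 := h 0 0 x
    rw [partialDeriv_zero_eq hf] at h1
    simpa [multiFactorial, wordOp, hn] using h1
  have hn1 : (1 : ℝ) ≤ n := by exact_mod_cast h0
  have hns : (1 : ℝ) ≤ (n : ℝ) ^ s := Real.one_le_rpow hn1 hs0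
  have hQ2 : (n : ℝ) ≤ (K * (n : ℝ) ^ s) ^ 2 := by
    -- Here s ≥ 1/2 enters: n ≤ n^{2s}.
    have h1 : (n : ℝ) ≤ ((n : ℝ) ^ s) ^ 2 := by
      rw [← Real.rpow_natCast, ← Real.rpow_mul (by positivity)]
      calc (n : ℝ) = (n : ℝ) ^ (1 : ℝ) := (Real.rpow_one _).symm
        _ ≤ _ := Real.rpow_le_rpow_of_exponent_le hn1 (by push_cast; linarith)
    refine h1.trans (pow_le_pow_left₀ (by positivity) ?_ 2)
    exact le_mul_of_one_le_left (by positivity) hK1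
  have key := norm_wordOp_normalForm_le (n := n) (Q := K * (n : ℝ) ^ s) hf (by nlinarith) hQ2 hM
    ?_ w 0 0 x (by simp [hn])
  · have hnf : normalForm 0 0 f = f := by
      funext y
      simp [normalForm, partialDeriv_zero_eq hf]
    rw [hnf] at key
    simp only [Pi.zero_apply, Finset.sum_const_zero, add_zero, ← hn] at key
    have h3 : ((n : ℝ) ^ s) ^ n ≤ (Real.exp 1 ^ s) ^ n * (n.factorial : ℝ) ^ s := by
      calc ((n : ℝ) ^ s) ^ n = ((n : ℝ) ^ n) ^ s := by
            rw [← Real.rpow_natCast, ← Real.rpow_natCast, ← Real.rpow_mul (by positivity),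
              ← Real.rpow_mul (by positivity), mul_comm]
        _ ≤ (Real.exp 1 ^ n * n.factorial) ^ s :=
            Real.rpow_le_rpow (by positivity) (nat_pow_self_le_exp_mul_factorial n) hs0
        _ = _ := by
            rw [Real.mul_rpow (by positivity) (by positivity)]
            congr 1
            rw [← Real.rpow_natCast, ← Real.rpow_natCast, ← Real.rpow_mul (by positivity),
              ← Real.rpow_mul (by positivity), mul_comm]
    calc _ ≤ _ := key
      _ = M * (2 * K) ^ n * ((n : ℝ) ^ s) ^ n := by ring
      _ ≤ M * (2 * K) ^ n * ((Real.exp 1 ^ s) ^ n * (n.factorial : ℝ) ^ s) := by gcongr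
      _ = _ := by ring
  -- Up to degree n one has α! ≤ n^{|α|}, so the factorials in the hypothesis are absorbed into
  -- powers of Q.
  · intro α β y hαβ
    rw [norm_normalForm]
    refine (h α β y).trans ?_
    have hfac : ∀ γ : ι → ℕ, ∑ j, γ j ≤ n →
        (multiFactorial γ : ℝ) ^ s ≤ ((n : ℝ) ^ s) ^ ∑ j, γ j := by
      intro γ hγ
      calc (multiFactorial γ : ℝ) ^ s ≤ ((n : ℝ) ^ ∑ j, γ j) ^ s :=
            Real.rpow_le_rpow (by positivity)
              (by exact_mod_cast multiFactorial_le_pow γ hγ) hs0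
        _ = _ := by
            rw [← Real.rpow_natCast, ← Real.rpow_natCast, ← Real.rpow_mul (by positivity),
              ← Real.rpow_mul (by positivity), mul_comm]
    have h1 := hfac α (by omega)
    have h2 := hfac β (by omega)
    have hAK : A ≤ K := (le_max_left _ _).trans (le_max_right _ _)
    have hBK : B ≤ K := (le_max_right _ _).trans (le_max_right _ _)
    calc _ ≤ M * K ^ (∑ j, α j) * K ^ (∑ j, β j) * ((n : ℝ) ^ s) ^ (∑ j, α j) *
          ((n : ℝ) ^ s) ^ (∑ j, β j) := by gcongr
      _ = _ := by
        rw [mul_pow, pow_add, pow_add]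
        ring

theorem factorial_add_le (m n : ℕ) :
    (m + n).factorial ≤ 2 ^ (m + n) * (m.factorial * n.factorial) := by
  rw [← Nat.add_choose_mul_factorial_mul_factorial m n, mul_assoc]
  exact Nat.mul_le_mul_right _ (Nat.choose_le_two_pow _ _)

theorem factorial_sum_le {ι : Type} [DecidableEq ι] (t : Finset ι) (α : ι → ℕ) :
    (∑ j ∈ t, α j).factorial ≤
      (2 ^ t.card) ^ (∑ j ∈ t, α j) * ∏ j ∈ t, (α j).factorial := by
  induction t using Finset.induction_on with
  | empty => simp
  | insert a t ha ih =>
    rw [Finset.sum_insert ha, Finset.prod_insert ha, Finset.card_insert_of_notMem ha]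
    refine (factorial_add_le _ _).trans ?_
    set N := ∑ j ∈ t, α j
    calc _ ≤ 2 ^ (α a + N) * ((α a).factorial *
          ((2 ^ t.card) ^ (α a + N) * ∏ j ∈ t, (α j).factorial)) := by
          gcongr
          refine ih.trans (Nat.mul_le_mul_right _ ?_)
          exact Nat.pow_le_pow_right (by positivity) (Nat.le_add_left _ _)
      _ = _ := by
        rw [pow_succ, mul_pow (2 ^ t.card) 2]
        ring

theorem wordOp_map_pos {ι : Type} [Fintype ι] [DecidableEq ι] (v : List ι)
    (f : EuclideanSpace ℝ ι → ℂ) (x : EuclideanSpace ℝ ι) :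
    wordOp (v.map .pos) f x = (v.map fun j => (x j : ℂ)).prod * f x := by
  induction v generalizing f with
  | nil => simp [wordOp]
  | cons j v ih =>
    rw [List.map_cons, wordOp, ih, List.map_cons, List.prod_cons]
    simp only [letterOp]
    ring

/-- Bounds for all words in the coordinates and the partial derivatives imply the bounds that define
the Gelfand-Shilov space. -/
theorem exists_gelfandShilovBound_of_wordBound {ι : Type} [Fintype ι] [DecidableEq ι] {s : ℝ}
    (hs : 0 ≤ s) (C : ℝ) (hC : 1 ≤ C) :
    ∃ A : ℝ, 0 < A ∧ ∀ (f : EuclideanSpace ℝ ι → ℂ) (M : ℝ), 0 ≤ M →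
      WordBound s C M f → GelfandShilovBound s s A A M f := by
  -- One factor 2 splits (|α|+|β|)!, and 2^{card ι} compares |α|! with α!.
  set D : ℝ := 2 * 2 ^ Fintype.card ι with hD
  have hD0 : 0 < D := by positivity
  refine ⟨C * D ^ s, by positivity, fun f M hM h α β x => ?_⟩
  obtain ⟨u, hu, hu'⟩ := exists_list_count α
  obtain ⟨v, hv, hv'⟩ := exists_list_count β
  -- Derivatives act first and coordinates afterwards, so this word is x^α ∂^β.
  have h1 := h.2 (v.map .deriv ++ u.map .pos) x
  have h2 : wordOp (v.map .deriv ++ u.map .pos) f = normalForm α β f := by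
    funext y
    rw [wordOp_append, wordOp_map_pos, normalForm, partialDeriv_eq_derivList h.1 β hv']
    congr 1
    rw [Finset.prod_list_map_count]
    refine Finset.prod_subset_one_on_sdiff (Finset.subset_univ _) ?_ ?_
    · intro i hi
      have : i ∉ u := by simpa using hi
      rw [← hu', List.count_eq_zero_of_not_mem this, pow_zero]
    · intro i _
      rw [hu']
  rw [h2, norm_normalForm] at h1
  refine h1.trans ?_
  simp only [List.length_append, List.length_map, hu, hv]
  set a := ∑ j, α j
  set b := ∑ j, β j
  have hfac : ((b + a).factorial : ℝ) ≤ D ^ (a + b) * (multiFactorial α * multiFactorial β) := by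
    have e1 := factorial_add_le b a
    have e2 : a.factorial ≤ (2 ^ Fintype.card ι) ^ a * multiFactorial α :=
      factorial_sum_le Finset.univ α
    have e3 : b.factorial ≤ (2 ^ Fintype.card ι) ^ b * multiFactorial β :=
      factorial_sum_le Finset.univ β
    have e4 : (b + a).factorial ≤ 2 ^ (b + a) * (((2 ^ Fintype.card ι) ^ b * multiFactorial β) *
        ((2 ^ Fintype.card ι) ^ a * multiFactorial α)) :=
      e1.trans (Nat.mul_le_mul_left _ (Nat.mul_le_mul e3 e2))
    have e5 : ((b + a).factorial : ℝ) ≤ 2 ^ (b + a) * (((2 ^ Fintype.card ι) ^ b *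
        multiFactorial β) * ((2 ^ Fintype.card ι) ^ a * multiFactorial α)) := by
      exact_mod_cast e4
    refine e5.trans (le_of_eq ?_)
    rw [hD]
    ring
  have hfac' : ((b + a).factorial : ℝ) ^ s ≤
      (D ^ s) ^ (a + b) * ((multiFactorial α : ℝ) ^ s * (multiFactorial β : ℝ) ^ s) := by
    calc _ ≤ (D ^ (a + b) * ((multiFactorial α : ℝ) * multiFactorial β)) ^ s :=
          Real.rpow_le_rpow (by positivity) hfac hs
      _ = _ := by
        rw [Real.mul_rpow (by positivity) (by positivity),
          Real.mul_rpow (by positivity) (by positivity)]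
        congr 1
        rw [← Real.rpow_natCast, ← Real.rpow_natCast, ← Real.rpow_mul (by positivity),
          ← Real.rpow_mul (by positivity), mul_comm]
  calc _ ≤ M * (C ^ (b + a) * ((D ^ s) ^ (a + b) *
        ((multiFactorial α : ℝ) ^ s * (multiFactorial β : ℝ) ^ s))) := by gcongr
    _ = _ := by ring


/-! ### Stability under time-frequency shifts -/

section TimeFreqShift

variable {ι : Type} [Fintype ι] [DecidableEq ι] {f : EuclideanSpace ℝ ι → ℂ}

/-- The scalar by which a generator of the Weyl algebra changes under conjugation with a
time-frequency shift. -/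
def letterShift (x ξ : EuclideanSpace ℝ ι) : WeylLetter ι → ℂ
  | .pos j => (x j : ℂ)
  | .deriv j => 2 * Real.pi * Complex.I * (ξ j : ℂ)

omit [DecidableEq ι] in
theorem hasFDerivAt_cexp_inner (c : ℂ) (ξ t : EuclideanSpace ℝ ι) :
    HasFDerivAt (fun t => Complex.exp (c * (inner ℝ ξ t : ℝ)))
      ((Complex.exp (c * (inner ℝ ξ t : ℝ)) * c) • Complex.ofRealCLM.comp (innerSL ℝ ξ)) t := by
  have h := ((Complex.ofRealCLM.comp (innerSL ℝ ξ)).hasFDerivAt (x := t)).const_mul c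
  have h2 := h.cexp
  rw [smul_smul] at h2
  exact h2

omit [DecidableEq ι] in
theorem contDiff_timeFreqShift (hf : ContDiff ℝ ∞ f) (x ξ : EuclideanSpace ℝ ι) :
    ContDiff ℝ ∞ (timeFreqShift x ξ f) :=
  (Complex.contDiff_exp.comp (contDiff_const.mul
    (Complex.ofRealCLM.comp (innerSL ℝ ξ)).contDiff)).mul
      (hf.comp (contDiff_id.sub contDiff_const))

/-- Multiplication by t_j sees the translation as an additive x_j, and ∂_j sees the modulation
through the product rule as an additive 2πi ξ_j. -/
theorem letterOp_timeFreqShift (hf : ContDiff ℝ ∞ f) (x ξ : EuclideanSpace ℝ ι)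
    (l : WeylLetter ι) :
    letterOp l (timeFreqShift x ξ f) =
      timeFreqShift x ξ (letterOp l f) + letterShift x ξ l • timeFreqShift x ξ f := by
  funext t
  cases l with
  | pos j =>
    simp [letterOp, timeFreqShift, letterShift]
    ring
  | deriv j =>
    have h1 := hasFDerivAt_cexp_inner (2 * Real.pi * Complex.I) ξ t
    have h2 : HasFDerivAt (fun t => f (t - x)) (fderiv ℝ f (t - x)) t := by
      have h3 := (hf.differentiable_of_infty (t - x)).hasFDerivAt.comp t
        ((hasFDerivAt_id t).sub_const x)
      rwa [ContinuousLinearMap.comp_id] at h3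
    have h := (h1.mul h2).fderiv
    change fderiv ℝ ((fun t => Complex.exp (2 * Real.pi * Complex.I * (inner ℝ ξ t : ℝ))) *
      fun t => f (t - x)) t _ = _
    rw [h]
    simp [letterOp, timeFreqShift, letterShift, EuclideanSpace.inner_single_right]
    ring

omit [DecidableEq ι] in
theorem norm_timeFreqShift (x ξ : EuclideanSpace ℝ ι) (f : EuclideanSpace ℝ ι → ℂ)
    (t : EuclideanSpace ℝ ι) : ‖timeFreqShift x ξ f t‖ = ‖f (t - x)‖ := by
  rw [timeFreqShift, norm_mul, show (2 * Real.pi * Complex.I * (inner ℝ ξ t : ℝ) : ℂ) =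
    ((2 * Real.pi * inner ℝ ξ t : ℝ) : ℂ) * Complex.I by push_cast; ring,
    Complex.norm_exp_ofReal_mul_I, one_mul]

/-- Each letter is either kept or replaced by a scalar of size at most c, so only subwords of w
reach f; hence R has to bound all words that are no longer than w. -/
theorem norm_wordOp_timeFreqShift_le (hf : ContDiff ℝ ∞ f) {x ξ : EuclideanSpace ℝ ι} {c R : ℝ}
    (hc0 : 0 ≤ c) (hc : ∀ l, ‖letterShift x ξ l‖ ≤ c) (w : List (WeylLetter ι))
    (hR : ∀ w' : List (WeylLetter ι), w'.length ≤ w.length → ∀ t, ‖wordOp w' f t‖ ≤ R)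
    (t : EuclideanSpace ℝ ι) :
    ‖wordOp w (timeFreqShift x ξ f) t‖ ≤ (1 + c) ^ w.length * R := by
  induction w generalizing f with
  | nil =>
    rw [wordOp, norm_timeFreqShift]
    simpa [wordOp] using hR [] le_rfl (t - x)
  | cons l w ih =>
    rw [wordOp, letterOp_timeFreqShift hf, wordOp_add_smul
      (contDiff_timeFreqShift (contDiff_letterOp hf l) x ξ) (contDiff_timeFreqShift hf x ξ)]
    have h1 := ih (contDiff_letterOp hf l) fun w' hw' t => hR (l :: w') (by simpa using hw') t
    have h2 := ih hf fun w' hw' t => hR w' (hw'.trans (by simp)) t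
    calc _ ≤ ‖wordOp w (timeFreqShift x ξ (letterOp l f)) t‖ +
          ‖letterShift x ξ l‖ * ‖wordOp w (timeFreqShift x ξ f) t‖ := by
            refine (norm_add_le _ _).trans_eq ?_
            simp
      _ ≤ (1 + c) ^ w.length * R + c * ((1 + c) ^ w.length * R) :=
          add_le_add h1 (mul_le_mul (hc l) h2 (norm_nonneg _) hc0)
      _ = _ := by
        rw [List.length_cons]
        ring

theorem WordBound.nonneg {s C M : ℝ} (h : WordBound s C M f) : 0 ≤ M := by
  have := h.2 [] 0
  simp only [List.length_nil, pow_zero, Nat.factorial_zero, Nat.cast_one, Real.one_rpow,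
    mul_one] at this
  exact (norm_nonneg _).trans this

theorem pow_mul_factorial_rpow_mono {s C : ℝ} (hs : 0 ≤ s) (hC : 1 ≤ C) {m n : ℕ} (h : m ≤ n) :
    C ^ m * (m.factorial : ℝ) ^ s ≤ C ^ n * (n.factorial : ℝ) ^ s := by
  have h1 := pow_le_pow_right₀ hC h
  have h2 : (m.factorial : ℝ) ^ s ≤ (n.factorial : ℝ) ^ s :=
    Real.rpow_le_rpow (by positivity) (by exact_mod_cast Nat.factorial_le h) hs
  exact mul_le_mul h1 h2 (by positivity) (by positivity)

theorem WordBound.mono {s C C' M : ℝ} (h : WordBound s C M f) (hC : 0 ≤ C) (hC' : C ≤ C') :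
    WordBound s C' M f := by
  refine ⟨h.1, fun w x => (h.2 w x).trans ?_⟩
  have := h.nonneg
  gcongr

theorem WordBound.timeFreqShift {s C M : ℝ} (hs : 0 ≤ s) (hC : 1 ≤ C) (h : WordBound s C M f)
    (x ξ : EuclideanSpace ℝ ι) : ∃ C', 1 ≤ C' ∧ WordBound s C' M (timeFreqShift x ξ f) := by
  set c : ℝ := ∑ j, ‖letterShift x ξ (.pos j)‖ + ∑ j, ‖letterShift x ξ (.deriv j)‖
  have hc0 : 0 ≤ c := by positivity
  have hc : ∀ l, ‖letterShift x ξ l‖ ≤ c := by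
    intro l
    cases l with
    | pos j =>
      exact (Finset.single_le_sum (f := fun j => ‖letterShift x ξ (.pos j)‖)
        (fun _ _ => norm_nonneg _) (Finset.mem_univ j)).trans
        (le_add_of_nonneg_right (by positivity))
    | deriv j =>
      exact (Finset.single_le_sum (f := fun j => ‖letterShift x ξ (.deriv j)‖)
        (fun _ _ => norm_nonneg _) (Finset.mem_univ j)).trans
        (le_add_of_nonneg_left (by positivity))
  refine ⟨(1 + c) * C, by nlinarith, contDiff_timeFreqShift h.1 x ξ, fun w t => ?_⟩
  have hM := h.nonneg
  refine (norm_wordOp_timeFreqShift_le h.1 hc0 hc w (R := M * (C ^ w.length *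
    (w.length.factorial : ℝ) ^ s)) (fun w' hw' t => (h.2 w' t).trans ?_) t).trans_eq ?_
  · exact mul_le_mul_of_nonneg_left (pow_mul_factorial_rpow_mono hs hC hw') hM
  · rw [mul_pow]
    ring

/-- For `s ≥ 1/2` the time-frequency shifts preserve `S^s_s`. -/
theorem timeFreqShift_mem_gelfandShilov {s : ℝ} (hs : 1 / 2 ≤ s)
    (hf : f ∈ gelfandShilov s s ι) (x ξ : EuclideanSpace ℝ ι) :
    timeFreqShift x ξ f ∈ gelfandShilov s s ι := by
  obtain ⟨hf, A, B, M, hA, hB, hM, h⟩ := hf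
  obtain ⟨C, hC, hC'⟩ := exists_wordBound_of_gelfandShilovBound (ι := ι) hs A B hA hB
  obtain ⟨D, hD, h'⟩ := (hC' f M hf h).timeFreqShift (by linarith) hC x ξ
  obtain ⟨A', hA', h''⟩ := exists_gelfandShilovBound_of_wordBound (ι := ι) (s := s)
    (by linarith) D hD
  exact ⟨h'.1, A', A', M, hA', hA', hM, h'' _ M hM.le h'⟩

end TimeFreqShift

/-! ### Polynomial decay from word bounds -/

section Decay

variable {ι : Type} [Fintype ι] [DecidableEq ι] {p q : EuclideanSpace ℝ ι → ℂ}

/-- `p` is smooth and all words in the coordinates and the partial derivatives map it to bounded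
functions, i.e. `p` is a Schwartz function. -/
def RapidDecay (p : EuclideanSpace ℝ ι → ℂ) : Prop :=
  ContDiff ℝ ∞ p ∧ ∀ w : List (WeylLetter ι), ∃ R : ℝ, ∀ x, ‖wordOp w p x‖ ≤ R

theorem RapidDecay.letterOp (hp : RapidDecay p) (l : WeylLetter ι) : RapidDecay (letterOp l p) :=
  ⟨contDiff_letterOp hp.1 l, fun w => hp.2 (l :: w)⟩

theorem WordBound.rapidDecay {s C M : ℝ} (h : WordBound s C M p) : RapidDecay p :=
  ⟨h.1, fun w => ⟨_, h.2 w⟩⟩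

omit [DecidableEq ι] in
theorem EuclideanSpace.norm_le_sum_abs (x : EuclideanSpace ℝ ι) : ‖x‖ ≤ ∑ j, |x j| := by
  classical
  conv_lhs => rw [← (EuclideanSpace.basisFun ι ℝ).sum_repr x]
  refine (norm_sum_le _ _).trans_eq ?_
  simp [norm_smul]

theorem one_add_norm_pow_succ_mul_norm_le (p : EuclideanSpace ℝ ι → ℂ) (k : ℕ)
    (x : EuclideanSpace ℝ ι) :
    (1 + ‖x‖) ^ (k + 1) * ‖p x‖ ≤
      (1 + ‖x‖) ^ k * ‖p x‖ + ∑ j, (1 + ‖x‖) ^ k * ‖_root_.letterOp (.pos j) p x‖ := by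
  calc (1 + ‖x‖) ^ (k + 1) * ‖p x‖ = (1 + ‖x‖) ^ k * ((1 + ‖x‖) * ‖p x‖) := by ring
    _ ≤ (1 + ‖x‖) ^ k * ((1 + ∑ j, |x j|) * ‖p x‖) := by
      gcongr
      exact EuclideanSpace.norm_le_sum_abs x
    _ = _ := by
      rw [add_mul, Finset.sum_mul, mul_add, Finset.mul_sum, one_mul]
      simp [_root_.letterOp]

/-- Each power of 1 + ‖x‖ is traded for one coordinate letter. The constant is independent of p, as
the continuity of σ^w f requires; `RapidDecay.exists_bound` is the qualitative counterpart. -/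
theorem one_add_norm_pow_mul_norm_le {k : ℕ} {R : ℝ}
    (hR : ∀ w : List (WeylLetter ι), w.length ≤ k → ∀ x, ‖wordOp w p x‖ ≤ R)
    (x : EuclideanSpace ℝ ι) :
    (1 + ‖x‖) ^ k * ‖p x‖ ≤ (1 + Fintype.card ι) ^ k * R := by
  induction k generalizing p with
  | zero => simpa [wordOp] using hR [] le_rfl x
  | succ k ih =>
    calc _ ≤ _ := one_add_norm_pow_succ_mul_norm_le p k x
      _ ≤ (1 + Fintype.card ι) ^ k * R + ∑ _j : ι, (1 + Fintype.card ι) ^ k * R :=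
        add_le_add (ih fun w hw => hR w (by omega)) (Finset.sum_le_sum fun j _ =>
          ih fun w hw => hR (.pos j :: w) (by simpa using hw))
      _ = _ := by
        rw [Finset.sum_const, Finset.card_univ, nsmul_eq_mul]
        ring

theorem RapidDecay.exists_bound (hp : RapidDecay p) (k : ℕ) :
    ∃ R : ℝ, ∀ x, (1 + ‖x‖) ^ k * ‖p x‖ ≤ R := by
  induction k generalizing p with
  | zero =>
    obtain ⟨R, hR⟩ := hp.2 []
    exact ⟨R, fun x => by simpa [wordOp] using hR x⟩
  | succ k ih =>
    obtain ⟨R, hR⟩ := ih hp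
    choose S hS using fun j => ih (hp.letterOp (.pos j))
    exact ⟨R + ∑ j, S j, fun x => (one_add_norm_pow_succ_mul_norm_le p k x).trans
      (add_le_add (hR x) (Finset.sum_le_sum fun j _ => hS j x))⟩

end Decay


/-! ### Differentiating and multiplying the cross-Wigner distribution -/

section Wigner

open MeasureTheory

variable {d : ℕ} {p q : EuclideanSpace ℝ (Fin d) → ℂ}

/-- The position component as a continuous linear map. -/
def phasePosL (d : ℕ) : PhaseSpace d →L[ℝ] EuclideanSpace ℝ (Fin d) :=
  LinearMap.toContinuousLinearMap
    { toFun := phasePos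
      map_add' := fun _ _ => rfl
      map_smul' := fun _ _ => rfl }

/-- The frequency component as a continuous linear map. -/
def phaseFreqL (d : ℕ) : PhaseSpace d →L[ℝ] EuclideanSpace ℝ (Fin d) :=
  LinearMap.toContinuousLinearMap
    { toFun := phaseFreq
      map_add' := fun _ _ => rfl
      map_smul' := fun _ _ => rfl }

/-- The `i`-th coordinate as a continuous real-linear map to `ℂ`. -/
def coordL {ι : Type} [Fintype ι] (i : ι) : EuclideanSpace ℝ ι →L[ℝ] ℂ :=
  Complex.ofRealCLM.comp (EuclideanSpace.proj (𝕜 := ℝ) i)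

theorem coordL_apply {ι : Type} [Fintype ι] (i : ι) (x : EuclideanSpace ℝ ι) :
    coordL i x = (x i : ℂ) := rfl

theorem conj_letterOp_pos {ι : Type} [Fintype ι] [DecidableEq ι] (j : ι)
    (f : EuclideanSpace ℝ ι → ℂ) (x : EuclideanSpace ℝ ι) :
    (starRingEnd ℂ) (letterOp (.pos j) f x) = (x j : ℂ) * (starRingEnd ℂ) (f x) := by
  simp only [letterOp, map_mul, Complex.conj_ofReal]

/-- The integrand of the cross-Wigner distribution. -/
def wignerIntegrand (p q : EuclideanSpace ℝ (Fin d) → ℂ) (z : PhaseSpace d)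
    (t : EuclideanSpace ℝ (Fin d)) : ℂ :=
  p (phasePos z + (1 / 2 : ℝ) • t) * (starRingEnd ℂ) (q (phasePos z - (1 / 2 : ℝ) • t)) *
    Complex.exp (-(2 * Real.pi * Complex.I * (inner ℝ t (phaseFreq z) : ℝ)))

theorem norm_wignerIntegrand (p q : EuclideanSpace ℝ (Fin d) → ℂ) (z : PhaseSpace d)
    (t : EuclideanSpace ℝ (Fin d)) : ‖wignerIntegrand p q z t‖ =
      ‖p (phasePos z + (1 / 2 : ℝ) • t)‖ * ‖q (phasePos z - (1 / 2 : ℝ) • t)‖ := by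
  rw [wignerIntegrand, norm_mul, norm_mul, RCLike.norm_conj,
    show -(2 * Real.pi * Complex.I * (inner ℝ t (phaseFreq z) : ℝ) : ℂ) =
      ((-(2 * Real.pi * inner ℝ t (phaseFreq z)) : ℝ) : ℂ) * Complex.I by push_cast; ring,
    Complex.norm_exp_ofReal_mul_I, mul_one]

/-- The two arguments a, b of p and q differ by t, so 1 + ‖t‖ ≤ (1 + ‖a‖)(1 + ‖b‖): decay of p and q
becomes decay in t, uniformly in z. -/
theorem norm_wignerIntegrand_le {k : ℕ} {P Q : ℝ} (hp : ∀ x, (1 + ‖x‖) ^ k * ‖p x‖ ≤ P)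
    (hq : ∀ x, (1 + ‖x‖) ^ k * ‖q x‖ ≤ Q) (z : PhaseSpace d) (t : EuclideanSpace ℝ (Fin d)) :
    ‖wignerIntegrand p q z t‖ ≤ P * Q * (1 + ‖t‖) ^ (-(k : ℝ)) := by
  rw [norm_wignerIntegrand, Real.rpow_neg (by positivity), Real.rpow_natCast, ← div_eq_mul_inv,
    le_div_iff₀ (by positivity)]
  set a := phasePos z + (1 / 2 : ℝ) • t with ha
  set b := phasePos z - (1 / 2 : ℝ) • t with hb
  have hab : t = a - b := by
    rw [ha, hb]
    module
  have h1 : 1 + ‖t‖ ≤ (1 + ‖a‖) * (1 + ‖b‖) := by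
    have h2 : ‖t‖ ≤ ‖a‖ + ‖b‖ := hab ▸ norm_sub_le a b
    nlinarith [mul_nonneg (norm_nonneg a) (norm_nonneg b)]
  calc ‖p a‖ * ‖q b‖ * (1 + ‖t‖) ^ k ≤ ‖p a‖ * ‖q b‖ * ((1 + ‖a‖) * (1 + ‖b‖)) ^ k := by gcongr
    _ = ((1 + ‖a‖) ^ k * ‖p a‖) * ((1 + ‖b‖) ^ k * ‖q b‖) := by
      rw [mul_pow]
      ring
    _ ≤ P * Q := mul_le_mul (hp a) (hq b) (by positivity) (le_trans (by positivity) (hp a))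

/-- The exponent d+1 is the least integer above the dimension; it fixes the number of extra letters
spent in every sup bound for W. -/
theorem integrable_one_add_norm_succ (d : ℕ) :
    Integrable fun t : EuclideanSpace ℝ (Fin d) => (1 + ‖t‖) ^ (-((d + 1 : ℕ) : ℝ)) :=
  integrable_one_add_norm (by simp)

theorem RapidDecay.exists_wignerIntegrand_bound (hp : RapidDecay p) (hq : RapidDecay q) :
    ∃ R : ℝ, ∀ z t, ‖wignerIntegrand p q z t‖ ≤ R * (1 + ‖t‖) ^ (-((d + 1 : ℕ) : ℝ)) := by
  obtain ⟨P, hP⟩ := hp.exists_bound (d + 1)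
  obtain ⟨Q, hQ⟩ := hq.exists_bound (d + 1)
  exact ⟨P * Q, norm_wignerIntegrand_le hP hQ⟩

theorem continuous_wignerIntegrand (hp : Continuous p) (hq : Continuous q) (z : PhaseSpace d) :
    Continuous (wignerIntegrand p q z) := by
  unfold wignerIntegrand
  have := RCLike.continuous_conj (K := ℂ)
  fun_prop

theorem integrable_wignerIntegrand (hp : RapidDecay p) (hq : RapidDecay q) (z : PhaseSpace d) :
    Integrable (wignerIntegrand p q z) := by
  obtain ⟨R, hR⟩ := hp.exists_wignerIntegrand_bound hq
  exact ((integrable_one_add_norm_succ d).const_mul R).mono'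
    (continuous_wignerIntegrand hp.1.continuous hq.1.continuous z).aestronglyMeasurable
    (Filter.Eventually.of_forall fun t => hR z t)

/-- A bound for the cross-Wigner distribution by finitely many words. -/
theorem exists_norm_crossWigner_le (d : ℕ) : ∃ K : ℝ, 0 ≤ K ∧
    ∀ (p q : EuclideanSpace ℝ (Fin d) → ℂ) (P Q : ℝ),
      (∀ w : List (WeylLetter (Fin d)), w.length ≤ d + 1 → ∀ x, ‖wordOp w p x‖ ≤ P) →
      (∀ w : List (WeylLetter (Fin d)), w.length ≤ d + 1 → ∀ x, ‖wordOp w q x‖ ≤ Q) →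
      ∀ z, ‖crossWigner p q z‖ ≤ K * (P * Q) := by
  set c : ℝ := (1 + Fintype.card (Fin d)) ^ (d + 1)
  refine ⟨c * c * ∫ t : EuclideanSpace ℝ (Fin d), (1 + ‖t‖) ^ (-((d + 1 : ℕ) : ℝ)), ?_,
    fun p q P Q hp hq z => ?_⟩
  · exact mul_nonneg (by positivity) (integral_nonneg fun t => by positivity)
  · have h := norm_wignerIntegrand_le (one_add_norm_pow_mul_norm_le hp)
      (one_add_norm_pow_mul_norm_le hq) z
    calc ‖crossWigner p q z‖ ≤ ∫ t : EuclideanSpace ℝ (Fin d),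
          (c * P) * (c * Q) * (1 + ‖t‖) ^ (-((d + 1 : ℕ) : ℝ)) :=
        norm_integral_le_of_norm_le ((integrable_one_add_norm_succ d).const_mul _)
          (Filter.Eventually.of_forall h)
      _ = _ := by
        rw [integral_const_mul]
        ring

theorem fderiv_apply_eq_sum_letterOp {ι : Type} [Fintype ι] [DecidableEq ι]
    (f : EuclideanSpace ℝ ι → ℂ) (x v : EuclideanSpace ℝ ι) :
    fderiv ℝ f x v = ∑ j, (v j : ℂ) * letterOp (.deriv j) f x := by
  conv_lhs => rw [← (EuclideanSpace.basisFun ι ℝ).sum_repr v]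
  rw [map_sum]
  simp [letterOp]

/-- The partial derivatives in `z` of the integrand of the cross-Wigner distribution. -/
def wignerIntegrandDeriv (p q : EuclideanSpace ℝ (Fin d) → ℂ) (z : PhaseSpace d)
    (t : EuclideanSpace ℝ (Fin d)) : Fin d ⊕ Fin d → ℂ
  | .inl j => wignerIntegrand (letterOp (.deriv j) p) q z t +
      wignerIntegrand p (letterOp (.deriv j) q) z t
  | .inr j => -(2 * Real.pi * Complex.I) * (wignerIntegrand (letterOp (.pos j) p) q z t -
      wignerIntegrand p (letterOp (.pos j) q) z t)

/-- A position derivative falls on p or q. A frequency derivative brings down -2πi t_j, and t_j is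
the difference of the j-th coordinates of the two arguments, hence a coordinate letter on p minus
one on q. -/
theorem hasFDerivAt_wignerIntegrand (hp : ContDiff ℝ ∞ p) (hq : ContDiff ℝ ∞ q)
    (z : PhaseSpace d) (t : EuclideanSpace ℝ (Fin d)) :
    HasFDerivAt (fun z => wignerIntegrand p q z t)
      (∑ i, wignerIntegrandDeriv p q z t i •
        coordL i) z := by
  have h1 : HasFDerivAt (fun z => p (phasePosL d z + (1 / 2 : ℝ) • t)) _ z :=
    (hp.differentiable_of_infty _).hasFDerivAt.comp z
      ((phasePosL d).hasFDerivAt.add_const ((1 / 2 : ℝ) • t))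
  have h2 : HasFDerivAt (fun z => (starRingEnd ℂ) (q (phasePosL d z - (1 / 2 : ℝ) • t))) _ z :=
    Complex.conjCLE.toContinuousLinearMap.hasFDerivAt.comp z
      ((hq.differentiable_of_infty _).hasFDerivAt.comp z
        ((phasePosL d).hasFDerivAt.sub_const ((1 / 2 : ℝ) • t)))
  have h3 : HasFDerivAt (fun z => Complex.exp (-(2 * Real.pi * Complex.I) *
      (inner ℝ t (phaseFreqL d z) : ℝ))) _ z :=
    (hasFDerivAt_cexp_inner (-(2 * Real.pi * Complex.I)) t _).comp z
      (phaseFreqL d).hasFDerivAt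
  have h := (h1.mul h2).mul h3
  have hfun : (fun z => wignerIntegrand p q z t) =
      ((fun z => p (phasePosL d z + (1 / 2 : ℝ) • t)) *
        fun z => (starRingEnd ℂ) (q (phasePosL d z - (1 / 2 : ℝ) • t))) *
      fun z => Complex.exp (-(2 * Real.pi * Complex.I) * (inner ℝ t (phaseFreqL d z) : ℝ)) := by
    funext z
    simp only [wignerIntegrand, Pi.mul_apply, neg_mul]
    rfl
  rw [hfun]
  refine h.congr_fderiv ?_
  ext v
  have hpos : ∀ v : PhaseSpace d, phasePosL d v = phasePos v := fun _ => rfl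
  have hfreq : ∀ v : PhaseSpace d, phaseFreqL d v = phaseFreq v := fun _ => rfl
  have hinner : ((inner ℝ t (phaseFreq v) : ℝ) : ℂ) = ∑ j, (v (.inr j) : ℂ) * (t j : ℂ) := by
    simp [PiLp.inner_apply, phaseFreq]
  have ht : ∀ j, (t j : ℂ) = (((phasePos z + (1 / 2 : ℝ) • t) j : ℝ) : ℂ) -
      (((phasePos z - (1 / 2 : ℝ) • t) j : ℝ) : ℂ) := by
    intro j
    simp
    ring
  simp only [add_apply, smul_apply, ContinuousLinearMap.comp_apply, sum_apply,
    ContinuousLinearEquiv.coe_coe, Complex.conjCLE_apply, hpos, hfreq, innerSL_apply_apply,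
    Complex.ofRealCLM_apply, hinner, Pi.mul_apply, Fintype.sum_sum_type, smul_eq_mul,
    coordL_apply, fderiv_apply_eq_sum_letterOp _ _ (phasePos v), map_sum, map_mul,
    Complex.conj_ofReal]
  simp only [wignerIntegrandDeriv, wignerIntegrand, Finset.mul_sum, ← Finset.sum_add_distrib]
  refine Finset.sum_congr rfl fun j _ => ?_
  simp only [neg_mul]
  have hv : (phasePos v) j = v (.inl j) := rfl
  rw [hv]
  have e1 : letterOp (.pos j) p (phasePos z + (1 / 2 : ℝ) • t) =
    (((phasePos z + (1 / 2 : ℝ) • t) j : ℝ) : ℂ) * p (phasePos z + (1 / 2 : ℝ) • t) := rfl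
  have e2 : (starRingEnd ℂ) (letterOp (.pos j) q (phasePos z - (1 / 2 : ℝ) • t)) =
    (((phasePos z - (1 / 2 : ℝ) • t) j : ℝ) : ℂ) *
      (starRingEnd ℂ) (q (phasePos z - (1 / 2 : ℝ) • t)) := by
    exact conj_letterOp_pos j q _
  rw [e1, e2, ht]
  ring

/-- The partial derivatives of the cross-Wigner distribution. -/
def crossWignerDeriv (p q : EuclideanSpace ℝ (Fin d) → ℂ) (z : PhaseSpace d) : Fin d ⊕ Fin d → ℂ
  | .inl j => crossWigner (letterOp (.deriv j) p) q z + crossWigner p (letterOp (.deriv j) q) z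
  | .inr j => -(2 * Real.pi * Complex.I) * (crossWigner (letterOp (.pos j) p) q z -
      crossWigner p (letterOp (.pos j) q) z)

theorem integrable_wignerIntegrandDeriv (hp : RapidDecay p) (hq : RapidDecay q)
    (z : PhaseSpace d) (i : Fin d ⊕ Fin d) :
    Integrable fun t => wignerIntegrandDeriv p q z t i := by
  cases i with
  | inl j =>
    exact (integrable_wignerIntegrand (hp.letterOp _) hq z).add
      (integrable_wignerIntegrand hp (hq.letterOp _) z)
  | inr j =>
    exact ((integrable_wignerIntegrand (hp.letterOp _) hq z).sub
      (integrable_wignerIntegrand hp (hq.letterOp _) z)).const_mul _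

theorem integral_wignerIntegrandDeriv (hp : RapidDecay p) (hq : RapidDecay q)
    (z : PhaseSpace d) (i : Fin d ⊕ Fin d) :
    ∫ t, wignerIntegrandDeriv p q z t i = crossWignerDeriv p q z i := by
  cases i with
  | inl j =>
    exact integral_add (integrable_wignerIntegrand (hp.letterOp _) hq z)
      (integrable_wignerIntegrand hp (hq.letterOp _) z)
  | inr j =>
    simp only [wignerIntegrandDeriv]
    rw [integral_const_mul, integral_sub (integrable_wignerIntegrand (hp.letterOp _) hq z)
      (integrable_wignerIntegrand hp (hq.letterOp _) z)]
    rfl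

theorem exists_wignerIntegrandDeriv_bound (hp : RapidDecay p) (hq : RapidDecay q)
    (i : Fin d ⊕ Fin d) :
    ∃ R : ℝ, ∀ z t, ‖wignerIntegrandDeriv p q z t i‖ ≤
      R * (1 + ‖t‖) ^ (-((d + 1 : ℕ) : ℝ)) := by
  cases i with
  | inl j =>
    obtain ⟨P, hP⟩ := (hp.letterOp (.deriv j)).exists_wignerIntegrand_bound hq
    obtain ⟨Q, hQ⟩ := hp.exists_wignerIntegrand_bound (hq.letterOp (.deriv j))
    refine ⟨P + Q, fun z t => (norm_add_le _ _).trans ?_⟩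
    rw [add_mul]
    exact add_le_add (hP z t) (hQ z t)
  | inr j =>
    obtain ⟨P, hP⟩ := (hp.letterOp (.pos j)).exists_wignerIntegrand_bound hq
    obtain ⟨Q, hQ⟩ := hp.exists_wignerIntegrand_bound (hq.letterOp (.pos j))
    refine ⟨‖-(2 * Real.pi * Complex.I : ℂ)‖ * (P + Q), fun z t => ?_⟩
    rw [wignerIntegrandDeriv, norm_mul, mul_assoc _ (P + Q), add_mul]
    exact mul_le_mul_of_nonneg_left
      ((norm_sub_le _ _).trans (add_le_add (hP z t) (hQ z t))) (norm_nonneg _)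

theorem integrable_fderiv_wignerIntegrand (hp : RapidDecay p) (hq : RapidDecay q)
    (z : PhaseSpace d) (i : Fin d ⊕ Fin d) :
    Integrable fun t => wignerIntegrandDeriv p q z t i • coordL (ι := Fin d ⊕ Fin d) i :=
  (integrable_wignerIntegrandDeriv hp hq z i).smul_const _

theorem exists_fderiv_wignerIntegrand_bound (hp : RapidDecay p) (hq : RapidDecay q) :
    ∃ bound : EuclideanSpace ℝ (Fin d) → ℝ, Integrable bound ∧ ∀ z t,
      ‖∑ i, wignerIntegrandDeriv p q z t i • coordL (ι := Fin d ⊕ Fin d) i‖ ≤ bound t := by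
  choose R hR using fun i => exists_wignerIntegrandDeriv_bound hp hq i
  refine ⟨fun t => ∑ i, R i * (1 + ‖t‖) ^ (-((d + 1 : ℕ) : ℝ)) *
    ‖coordL (ι := Fin d ⊕ Fin d) i‖, integrable_finsetSum _ fun i _ =>
      ((integrable_one_add_norm_succ d).const_mul (R i)).mul_const _, fun z t => ?_⟩
  refine (norm_sum_le _ _).trans (Finset.sum_le_sum fun i _ => ?_)
  rw [norm_smul]
  exact mul_le_mul_of_nonneg_right (hR i z t) (norm_nonneg _)

theorem hasFDerivAt_crossWigner (hp : RapidDecay p) (hq : RapidDecay q) (z : PhaseSpace d) :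
    HasFDerivAt (crossWigner p q) (∑ i, crossWignerDeriv p q z i • coordL i) z := by
  obtain ⟨bound, hbound, hle⟩ := exists_fderiv_wignerIntegrand_bound hp hq
  have hint := integrable_fderiv_wignerIntegrand hp hq z
  -- The dominating function does not depend on z, so the whole space serves as the neighbourhood.
  have key := hasFDerivAt_integral_of_dominated_of_fderiv_le (𝕜 := ℝ) (F := wignerIntegrand p q)
    Filter.univ_mem
    (Filter.Eventually.of_forall fun z =>
      (integrable_wignerIntegrand hp hq z).aestronglyMeasurable)
    (integrable_wignerIntegrand hp hq z)
    (Finset.aestronglyMeasurable_fun_sum _ fun i _ => (hint i).aestronglyMeasurable)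
    (Filter.Eventually.of_forall fun t z _ => hle z t) hbound
    (Filter.Eventually.of_forall fun t z _ => hasFDerivAt_wignerIntegrand hp.1 hq.1 z t)
  rw [integral_finsetSum _ fun i _ => hint i] at key
  simp only [integral_smul_const, integral_wignerIntegrandDeriv hp hq] at key
  exact key

/-- The partial derivatives are again combinations of cross-Wigner distributions of rapidly decaying
functions, so the order of smoothness can be raised by induction over all p and q at once. -/
theorem contDiff_crossWigner (hp : RapidDecay p) (hq : RapidDecay q) :
    ContDiff ℝ ∞ (crossWigner p q) := by
  rw [contDiff_infty]
  intro n
  induction n generalizing p q with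
  | zero =>
    rw [Nat.cast_zero, contDiff_zero]
    exact continuous_iff_continuousAt.2 fun z => (hasFDerivAt_crossWigner hp hq z).continuousAt
  | succ n ih =>
    rw [Nat.cast_succ, contDiff_succ_iff_fderiv]
    refine ⟨fun z => (hasFDerivAt_crossWigner hp hq z).differentiableAt, by simp, ?_⟩
    rw [show fderiv ℝ (crossWigner p q) = fun z => ∑ i, crossWignerDeriv p q z i •
      coordL i from
        funext fun z => (hasFDerivAt_crossWigner hp hq z).fderiv]
    refine ContDiff.sum fun i _ => ContDiff.fun_smul ?_ contDiff_const
    cases i with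
    | inl j => exact (ih (hp.letterOp _) hq).add (ih hp (hq.letterOp _))
    | inr j => exact contDiff_const.mul ((ih (hp.letterOp _) hq).sub (ih hp (hq.letterOp _)))

theorem letterOp_deriv_crossWigner (hp : RapidDecay p) (hq : RapidDecay q)
    (i : Fin d ⊕ Fin d) (z : PhaseSpace d) :
    letterOp (.deriv i) (crossWigner p q) z = crossWignerDeriv p q z i := by
  simp only [letterOp]
  rw [(hasFDerivAt_crossWigner hp hq z).fderiv, sum_apply, Finset.sum_eq_single i]
  · simp [coordL_apply]
  · intro k _ hk
    simp [coordL_apply, hk]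
  · simp

/-- The position is the midpoint of the two arguments x + t/2 and x - t/2. -/
theorem letterOp_pos_inl_crossWigner (hp : RapidDecay p) (hq : RapidDecay q) (j : Fin d)
    (z : PhaseSpace d) :
    letterOp (.pos (.inl j)) (crossWigner p q) z =
      1 / 2 * (crossWigner (letterOp (.pos j) p) q z + crossWigner p (letterOp (.pos j) q) z) := by
  have h := integral_add (integrable_wignerIntegrand (hp.letterOp (.pos j)) hq z)
    (integrable_wignerIntegrand hp (hq.letterOp (.pos j)) z)
  change _ = crossWigner _ _ z + crossWigner _ _ z at h
  rw [← h, ← integral_const_mul]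
  change (z (.inl j) : ℂ) * ∫ t, wignerIntegrand p q z t = _
  rw [← integral_const_mul]
  refine integral_congr_ae (Filter.Eventually.of_forall fun t => ?_)
  have h1 : ((phasePos z + (1 / 2 : ℝ) • t) j : ℂ) = (z (.inl j) : ℂ) + 1 / 2 * (t j : ℂ) := by
    simp [phasePos]
  have h2 : ((phasePos z - (1 / 2 : ℝ) • t) j : ℂ) = (z (.inl j) : ℂ) - 1 / 2 * (t j : ℂ) := by
    simp [phasePos]
  simp only [wignerIntegrand, conj_letterOp_pos]
  simp only [letterOp, h1, h2]
  ring

/-- Multiplying the exponential by ξ_j is, up to -2πi, differentiating it in t_j. Integration by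
parts moves the derivative to p(x+t/2) conj q(x-t/2), where the inner factors ±1/2 produce the
difference and turn 2πi into 4πi. -/
theorem letterOp_pos_inr_crossWigner (hp : RapidDecay p) (hq : RapidDecay q) (j : Fin d)
    (z : PhaseSpace d) :
    letterOp (.pos (.inr j)) (crossWigner p q) z =
      1 / (4 * Real.pi * Complex.I) *
        (crossWigner (letterOp (.deriv j) p) q z - crossWigner p (letterOp (.deriv j) q) z) := by
  set v : EuclideanSpace ℝ (Fin d) := EuclideanSpace.single j 1
  set F : EuclideanSpace ℝ (Fin d) → ℂ := fun t =>
    p (phasePos z + (1 / 2 : ℝ) • t) * (starRingEnd ℂ) (q (phasePos z - (1 / 2 : ℝ) • t)) with hF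
  set e : EuclideanSpace ℝ (Fin d) → ℂ := fun t =>
    Complex.exp (-(2 * Real.pi * Complex.I) * (inner ℝ (phaseFreq z) t : ℝ)) with he
  have hW : ∀ p q : EuclideanSpace ℝ (Fin d) → ℂ, wignerIntegrand p q z = fun t =>
      p (phasePos z + (1 / 2 : ℝ) • t) * (starRingEnd ℂ) (q (phasePos z - (1 / 2 : ℝ) • t)) *
        e t := by
    intro p q
    funext t
    simp only [wignerIntegrand, he, neg_mul, real_inner_comm]
  have h1 : ∀ t, HasFDerivAt (fun t => p (phasePos z + (1 / 2 : ℝ) • t)) _ t := fun t =>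
    (hp.1.differentiable_of_infty _).hasFDerivAt.comp t
      (((hasFDerivAt_id t).const_smul (1 / 2 : ℝ)).const_add (phasePos z))
  have h2 : ∀ t, HasFDerivAt
      (fun t => (starRingEnd ℂ) (q (phasePos z - (1 / 2 : ℝ) • t))) _ t := fun t =>
    Complex.conjCLE.toContinuousLinearMap.hasFDerivAt.comp t
      ((hq.1.differentiable_of_infty _).hasFDerivAt.comp t
        (((hasFDerivAt_id t).const_smul (1 / 2 : ℝ)).const_sub (phasePos z)))
  have h3 := fun t => hasFDerivAt_cexp_inner (-(2 * Real.pi * Complex.I)) (phaseFreq z) t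
  have hdF : ∀ t, fderiv ℝ F t v * e t =
      1 / 2 * (wignerIntegrand (letterOp (.deriv j) p) q z t -
        wignerIntegrand p (letterOp (.deriv j) q) z t) := by
    intro t
    have := ((h1 t).mul (h2 t)).fderiv
    rw [show F = (fun t => p (phasePos z + (1 / 2 : ℝ) • t)) *
      fun t => (starRingEnd ℂ) (q (phasePos z - (1 / 2 : ℝ) • t)) from rfl, this, hW, hW]
    simp [letterOp, v]
    ring
  have hde : ∀ t, F t * fderiv ℝ e t v =
      -(2 * Real.pi * Complex.I) * ((z (.inr j) : ℂ) * wignerIntegrand p q z t) := by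
    intro t
    rw [(h3 t).fderiv, hW]
    simp [v, EuclideanSpace.inner_single_right, phaseFreq, hF, he]
    ring
  have hparts := integral_mul_fderiv_eq_neg_fderiv_mul_of_integrable (μ := volume) (f := F)
    (g := e) (v := v) ?_ ?_ ?_ (fun t _ => ((h1 t).mul (h2 t)).differentiableAt)
    (fun t _ => (h3 t).differentiableAt)
  · simp only [hdF, hde] at hparts
    rw [integral_const_mul, integral_const_mul, integral_const_mul,
      integral_sub (integrable_wignerIntegrand (hp.letterOp _) hq z)
        (integrable_wignerIntegrand hp (hq.letterOp _) z)] at hparts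
    change -(2 * Real.pi * Complex.I) * ((z (.inr j) : ℂ) * crossWigner p q z) =
      -(1 / 2 * (crossWigner _ _ z - crossWigner _ _ z)) at hparts
    simp only [letterOp] at hparts ⊢
    have hpi : (Real.pi : ℂ) ≠ 0 := by exact_mod_cast Real.pi_ne_zero
    have hI := Complex.I_ne_zero
    field_simp
    linear_combination (-2) * hparts
  · simp only [hdF]
    exact ((integrable_wignerIntegrand (hp.letterOp _) hq z).sub
      (integrable_wignerIntegrand hp (hq.letterOp _) z)).const_mul _
  · simp only [hde]
    exact ((integrable_wignerIntegrand hp hq z).const_mul _).const_mul _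
  · have := integrable_wignerIntegrand hp hq z
    rwa [hW] at this

end Wigner


/-! ### Words acting on cross-Wigner distributions -/

section WignerWords

variable {d : ℕ} {p q : EuclideanSpace ℝ (Fin d) → ℂ}

/-- A generator of the Weyl algebra of `ℝ^{2d}` acts on a cross-Wigner distribution through a
generator of the Weyl algebra of `ℝ^d` acting on one of the two arguments. -/
theorem exists_letterOp_crossWigner (l : WeylLetter (Fin d ⊕ Fin d)) :
    ∃ (l' : WeylLetter (Fin d)) (a b : ℂ), ‖a‖ ≤ 2 * Real.pi ∧ ‖b‖ ≤ 2 * Real.pi ∧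
      ∀ p q : EuclideanSpace ℝ (Fin d) → ℂ, RapidDecay p → RapidDecay q →
        letterOp l (crossWigner p q) =
          a • crossWigner (letterOp l' p) q + b • crossWigner p (letterOp l' q) := by
  have hpi := Real.pi_gt_three
  -- The coefficients that occur have modulus 1/2, 1/(4π), 1 and 2π, so 2π bounds them all.
  have hn1 : ‖(-(2 * Real.pi * Complex.I) : ℂ)‖ = 2 * Real.pi := by
    simp [abs_of_pos Real.pi_pos]
  have hn2 : ‖(1 / (4 * Real.pi * Complex.I) : ℂ)‖ ≤ 2 * Real.pi := by
    simp only [norm_div, norm_mul, norm_one, Complex.norm_I, Complex.norm_real, Real.norm_eq_abs,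
      abs_of_pos Real.pi_pos, Complex.norm_ofNat, mul_one]
    rw [div_le_iff₀ (by positivity)]
    nlinarith
  have hn3 : ‖(1 / 2 : ℂ)‖ ≤ 2 * Real.pi := by
    norm_num
    linarith
  have hn4 : ‖(1 : ℂ)‖ ≤ 2 * Real.pi := by
    norm_num
    linarith
  rcases l with (j | j) | (j | j)
  · refine ⟨.pos j, 1 / 2, 1 / 2, hn3, hn3, fun p q hp hq => funext fun z => ?_⟩
    rw [letterOp_pos_inl_crossWigner hp hq, mul_add]
    rfl
  · refine ⟨.deriv j, 1 / (4 * Real.pi * Complex.I), -(1 / (4 * Real.pi * Complex.I)), hn2, ?_,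
      fun p q hp hq => funext fun z => ?_⟩
    · rwa [norm_neg]
    · rw [letterOp_pos_inr_crossWigner hp hq]
      simp only [Pi.add_apply, Pi.smul_apply, smul_eq_mul]
      ring
  · refine ⟨.deriv j, 1, 1, hn4, hn4, fun p q hp hq => funext fun z => ?_⟩
    rw [letterOp_deriv_crossWigner hp hq, one_smul, one_smul]
    rfl
  · refine ⟨.pos j, -(2 * Real.pi * Complex.I), 2 * Real.pi * Complex.I, hn1.le, ?_,
      fun p q hp hq => funext fun z => ?_⟩
    · rw [← norm_neg, hn1]
    · rw [letterOp_deriv_crossWigner hp hq, crossWignerDeriv]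
      simp only [Pi.add_apply, Pi.smul_apply, smul_eq_mul]
      ring

/-- Every letter goes to the left or to the right argument with a coefficient of size at most 2π;
the two choices make 4π per letter. -/
theorem norm_wordOp_crossWigner_le (hp : RapidDecay p) (hq : RapidDecay q)
    (w : List (WeylLetter (Fin d ⊕ Fin d))) {R : ℝ}
    (hR : ∀ w₁ w₂ : List (WeylLetter (Fin d)), w₁.length + w₂.length = w.length → ∀ z,
      ‖crossWigner (wordOp w₁ p) (wordOp w₂ q) z‖ ≤ R) (z : PhaseSpace d) :
    ‖wordOp w (crossWigner p q) z‖ ≤ (4 * Real.pi) ^ w.length * R := by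
  induction w generalizing p q with
  | nil => simpa [wordOp] using hR [] [] rfl z
  | cons l w ih =>
    obtain ⟨l', a, b, ha, hb, h⟩ := exists_letterOp_crossWigner l
    have hp' := hp.letterOp l'
    have hq' := hq.letterOp l'
    have hc : ContDiff ℝ ∞ (a • crossWigner (letterOp l' p) q) :=
      (contDiff_crossWigner hp' hq).const_smul a
    rw [wordOp, h p q hp hq, wordOp_add_smul hc (contDiff_crossWigner hp hq'),
      wordOp_smul (contDiff_crossWigner hp' hq)]
    have h1 := ih hp' hq fun w₁ w₂ hw z => hR (l' :: w₁) w₂ (by simp; omega) z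
    have h2 := ih hp hq' fun w₁ w₂ hw z => hR w₁ (l' :: w₂) (by simp; omega) z
    have hpi := Real.pi_pos
    calc _ ≤ ‖a‖ * ‖wordOp w (crossWigner (letterOp l' p) q) z‖ +
          ‖b‖ * ‖wordOp w (crossWigner p (letterOp l' q)) z‖ := by
            refine (norm_add_le _ _).trans_eq ?_
            simp
      _ ≤ 2 * Real.pi * ((4 * Real.pi) ^ w.length * R) +
          2 * Real.pi * ((4 * Real.pi) ^ w.length * R) :=
        add_le_add (mul_le_mul ha h1 (norm_nonneg _) (by positivity))
          (mul_le_mul hb h2 (norm_nonneg _) (by positivity))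
      _ = _ := by
        rw [List.length_cons]
        ring

theorem pow_mul_factorial_add_rpow_le {s C : ℝ} (hs : 0 ≤ s) (hC : 0 ≤ C) (m n : ℕ) :
    C ^ (m + n) * ((m + n).factorial : ℝ) ^ s ≤
      ((C * 2 ^ s) ^ m * (m.factorial : ℝ) ^ s) * ((C * 2 ^ s) ^ n * (n.factorial : ℝ) ^ s) := by
  have h : ((m + n).factorial : ℝ) ≤ 2 ^ (m + n) * (m.factorial * n.factorial) := by
    exact_mod_cast factorial_add_le m n
  have h1 : ((m + n).factorial : ℝ) ^ s ≤
      (2 ^ s) ^ (m + n) * ((m.factorial : ℝ) ^ s * (n.factorial : ℝ) ^ s) := by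
    refine (Real.rpow_le_rpow (by positivity) h hs).trans_eq ?_
    rw [Real.mul_rpow (by positivity) (by positivity),
      Real.mul_rpow (by positivity) (by positivity), ← Real.rpow_natCast, ← Real.rpow_natCast,
      ← Real.rpow_mul (by positivity), ← Real.rpow_mul (by positivity), mul_comm s]
  calc _ ≤ C ^ (m + n) * ((2 ^ s) ^ (m + n) *
        ((m.factorial : ℝ) ^ s * (n.factorial : ℝ) ^ s)) := by gcongr
    _ = _ := by ring

/-- The word w' holds the at most k letters spent on a sup bound. Enlarging C to C 2^s separates
their cost, which is independent of w, from that of w. -/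
theorem WordBound.norm_wordOp_wordOp_le {ι : Type} [Fintype ι] [DecidableEq ι] {s C M : ℝ}
    {f : EuclideanSpace ℝ ι → ℂ} (h : WordBound s C M f) (hs : 0 ≤ s) (hC : 1 ≤ C) {k : ℕ}
    (w w' : List (WeylLetter ι)) (hw' : w'.length ≤ k) (x : EuclideanSpace ℝ ι) :
    ‖wordOp w' (wordOp w f) x‖ ≤ M * (((C * 2 ^ s) ^ w.length * (w.length.factorial : ℝ) ^ s) *
      ((C * 2 ^ s) ^ k * (k.factorial : ℝ) ^ s)) := by
  rw [← wordOp_append]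
  refine (h.2 _ x).trans (mul_le_mul_of_nonneg_left ?_ h.nonneg)
  rw [List.length_append]
  exact (pow_mul_factorial_rpow_mono hs hC (by omega)).trans
    (pow_mul_factorial_add_rpow_le hs (by linarith) w.length k)

theorem RapidDecay.wordOp {ι : Type} [Fintype ι] [DecidableEq ι] {f : EuclideanSpace ℝ ι → ℂ}
    (h : RapidDecay f) (w : List (WeylLetter ι)) : RapidDecay (wordOp w f) := by
  induction w generalizing f with
  | nil => exact h
  | cons l w ih => exact ih (h.letterOp l)

/-- The cross-Wigner distribution of two functions in `S^s_s`, quantitatively. -/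
theorem exists_wordBound_crossWigner (d : ℕ) {s C : ℝ} (hs : 0 ≤ s) (hC : 1 ≤ C) :
    ∃ C' K : ℝ, 1 ≤ C' ∧ 0 ≤ K ∧ ∀ (p q : EuclideanSpace ℝ (Fin d) → ℂ) (M N : ℝ),
      WordBound s C M p → WordBound s C N q → WordBound s C' (K * (M * N)) (crossWigner p q) := by
  obtain ⟨K, hK, hW⟩ := exists_norm_crossWigner_le d
  set D : ℝ := C * 2 ^ s
  have hD : 1 ≤ D := by
    have := Real.one_le_rpow (x := 2) (by norm_num) hs
    nlinarith
  set L : ℝ := D ^ (d + 1) * ((d + 1).factorial : ℝ) ^ s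
  have hpi := Real.pi_gt_three
  refine ⟨4 * Real.pi * D, K * (L * L), by nlinarith, by positivity, fun p q M N hp hq =>
    ⟨contDiff_crossWigner hp.rapidDecay hq.rapidDecay, fun w z => ?_⟩⟩
  have hM := hp.nonneg
  have hN := hq.nonneg
  refine (norm_wordOp_crossWigner_le hp.rapidDecay hq.rapidDecay w
    (R := K * (M * N * (L * L)) * (D ^ w.length * (w.length.factorial : ℝ) ^ s))
    (fun w₁ w₂ hw z => ?_) z).trans_eq ?_
  · refine (hW _ _ _ _ (fun w' hw' x => hp.norm_wordOp_wordOp_le hs hC w₁ w' hw' x)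
      (fun w' hw' x => hq.norm_wordOp_wordOp_le hs hC w₂ w' hw' x) z).trans ?_
    -- The factorials of the two halves recombine without loss, since m! n! ≤ (m+n)!.
    have h1 : ((w₁.length.factorial : ℝ)) ^ s * (w₂.length.factorial : ℝ) ^ s ≤
        (w.length.factorial : ℝ) ^ s := by
      rw [← Real.mul_rpow (by positivity) (by positivity), ← hw]
      refine Real.rpow_le_rpow (by positivity) ?_ hs
      exact_mod_cast Nat.le_of_dvd (Nat.factorial_pos _)
        (Nat.factorial_mul_factorial_dvd_factorial_add _ _)
    calc _ = K * (M * N * (L * L)) * (D ^ (w₁.length + w₂.length) *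
          ((w₁.length.factorial : ℝ) ^ s * (w₂.length.factorial : ℝ) ^ s)) := by ring
      _ ≤ _ := by
        rw [hw]
        gcongr
  · rw [mul_pow (4 * Real.pi)]
    ring

theorem exists_wordBound_of_mem_gelfandShilov {ι : Type} [Fintype ι] [DecidableEq ι] {s : ℝ}
    (hs : 1 / 2 ≤ s) {f : EuclideanSpace ℝ ι → ℂ} (hf : f ∈ gelfandShilov s s ι) :
    ∃ C M : ℝ, 1 ≤ C ∧ WordBound s C M f := by
  obtain ⟨hf, A, B, M, hA, hB, -, h⟩ := hf
  obtain ⟨C, hC, hC'⟩ := exists_wordBound_of_gelfandShilovBound (ι := ι) hs A B hA hB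
  exact ⟨C, M, hC, hC' f M hf h⟩

theorem WordBound.mem_gelfandShilov {ι : Type} [Fintype ι] [DecidableEq ι] {s C M : ℝ}
    (hs : 0 ≤ s) (hC : 1 ≤ C) {f : EuclideanSpace ℝ ι → ℂ} (hf : WordBound s C M f) :
    f ∈ gelfandShilov s s ι := by
  obtain ⟨A, hA, h⟩ := exists_gelfandShilovBound_of_wordBound (ι := ι) hs C hC
  have hM := hf.nonneg
  -- Membership asks for a strictly positive constant, while M may vanish.
  exact ⟨hf.1, A, A, M + 1, hA, hA, by linarith,
    (h f M hM hf).mono hA.le hA.le hM le_rfl le_rfl (by linarith)⟩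

theorem crossWigner_mem_gelfandShilov {s : ℝ} (hs : 1 / 2 ≤ s)
    (hp : p ∈ gelfandShilov s s (Fin d)) (hq : q ∈ gelfandShilov s s (Fin d)) :
    crossWigner p q ∈ gelfandShilov s s (Fin d ⊕ Fin d) := by
  obtain ⟨C, M, hC, h⟩ := exists_wordBound_of_mem_gelfandShilov hs hp
  obtain ⟨C', M', hC', h'⟩ := exists_wordBound_of_mem_gelfandShilov hs hq
  obtain ⟨D, K, hD, -, hW⟩ := exists_wordBound_crossWigner d (s := s) (C := max C C')
    (by linarith) (hC.trans (le_max_left _ _))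
  exact (hW p q M M' (h.mono (by linarith) (le_max_left _ _))
    (h'.mono (by linarith) (le_max_right _ _))).mem_gelfandShilov (by linarith) hD

end WignerWords

/-! ### Covariance of the Wigner distribution -/

section Covariance

variable {d : ℕ}

theorem inner_phaseRotation (z ζ : PhaseSpace d) :
    inner ℝ (phaseRotation d z) ζ =
      inner ℝ (phaseFreq z) (phasePos ζ) - inner ℝ (phasePos z) (phaseFreq ζ) := by
  simp [PiLp.inner_apply, phaseRotation, phaseFreq, phasePos, sub_eq_add_neg]

/-- Covariance of the cross-Wigner distribution under time-frequency shifts. -/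
theorem crossWigner_phaseShift (f g : EuclideanSpace ℝ (Fin d) → ℂ) (w z : PhaseSpace d) :
    ∃ c : ℂ, ‖c‖ = 1 ∧ crossWigner (phaseShift w f) (phaseShift z g) =
      c • timeFreqShift ((1 / 2 : ℝ) • (z + w)) (phaseRotation d (w - z)) (crossWigner f g) := by
  -- Substituting t + δ for t centres both arguments at the position of ζ - (z+w)/2. Only
  -- exponentials then remain to be compared; what depends on neither t nor ζ is the phase c.
  set δ := phasePos w - phasePos z with hδ
  refine ⟨Complex.exp ((Real.pi * inner ℝ (phaseFreq w + phaseFreq z) δ : ℝ) * Complex.I),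
    Complex.norm_exp_ofReal_mul_I _, funext fun ζ => ?_⟩
  set c := Complex.exp ((Real.pi * inner ℝ (phaseFreq w + phaseFreq z) δ : ℝ) * Complex.I) with hc
  rw [Pi.smul_apply, smul_eq_mul, timeFreqShift, crossWigner, crossWigner,
    ← MeasureTheory.integral_const_mul, ← MeasureTheory.integral_const_mul,
    ← MeasureTheory.integral_add_right_eq_self _ δ]
  refine MeasureTheory.integral_congr_ae (Filter.Eventually.of_forall fun t => ?_)
  have hpos : phasePos (ζ - (1 / 2 : ℝ) • (z + w)) =
      phasePos ζ - (1 / 2 : ℝ) • (phasePos z + phasePos w) := rfl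
  have hfreq : phaseFreq (ζ - (1 / 2 : ℝ) • (z + w)) =
      phaseFreq ζ - (1 / 2 : ℝ) • (phaseFreq z + phaseFreq w) := rfl
  have hposw : phasePos (w - z) = phasePos w - phasePos z := rfl
  have hfreqw : phaseFreq (w - z) = phaseFreq w - phaseFreq z := rfl
  have h1 : phasePos ζ + (1 / 2 : ℝ) • (t + δ) - phasePos w =
      phasePos (ζ - (1 / 2 : ℝ) • (z + w)) + (1 / 2 : ℝ) • t := by
    rw [hpos, hδ]
    module
  have h2 : phasePos ζ - (1 / 2 : ℝ) • (t + δ) - phasePos z =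
      phasePos (ζ - (1 / 2 : ℝ) • (z + w)) - (1 / 2 : ℝ) • t := by
    rw [hpos, hδ]
    module
  simp only [phaseShift, timeFreqShift, h1, h2, map_mul, ← Complex.exp_conj]
  have hexp : Complex.exp (2 * Real.pi * Complex.I *
        (inner ℝ (phaseFreq w) (phasePos ζ + (1 / 2 : ℝ) • (t + δ)) : ℝ)) *
      Complex.exp ((starRingEnd ℂ) 2 * (starRingEnd ℂ) Real.pi * (starRingEnd ℂ) Complex.I *
        (starRingEnd ℂ) (inner ℝ (phaseFreq z) (phasePos ζ - (1 / 2 : ℝ) • (t + δ)) : ℝ)) *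
      Complex.exp (-(2 * Real.pi * Complex.I * (inner ℝ (t + δ) (phaseFreq ζ) : ℝ))) =
      c * Complex.exp (2 * Real.pi * Complex.I * (inner ℝ (phaseRotation d (w - z)) ζ : ℝ)) *
        Complex.exp (-(2 * Real.pi * Complex.I *
          (inner ℝ t (phaseFreq (ζ - (1 / 2 : ℝ) • (z + w))) : ℝ))) := by
    rw [hc, ← Complex.exp_add, ← Complex.exp_add, ← Complex.exp_add, ← Complex.exp_add]
    congr 1
    rw [inner_phaseRotation, hfreq, hposw, hfreqw, ← hδ]
    simp only [inner_add_left, inner_add_right, inner_sub_left, inner_sub_right,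
      inner_smul_right, Complex.conj_ofReal, Complex.conj_I, map_ofNat,
      real_inner_comm t, real_inner_comm (phaseFreq ζ) δ]
    push_cast
    ring
  linear_combination (f (phasePos (ζ - (1 / 2 : ℝ) • (z + w)) + (1 / 2 : ℝ) • t) *
    (starRingEnd ℂ) (g (phasePos (ζ - (1 / 2 : ℝ) • (z + w)) - (1 / 2 : ℝ) • t))) * hexp

end Covariance

/-! ### Existence, uniqueness and matrix coefficients of the Weyl operator -/

section WeylOperator

/-- Stating the hypothesis for the underlying functions lets the three test functions carry
unrelated membership proofs. -/
theorem ultraBracket_of_eq_add {s r : ℝ} {ι : Type} [Fintype ι] [DecidableEq ι]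
    (σ : ultraDistribution s r ι) {χ φ ψ : gelfandShilov s r ι}
    (h : (χ : EuclideanSpace ℝ ι → ℂ) = φ + ψ) :
    ultraBracket σ χ = ultraBracket σ φ + ultraBracket σ ψ := by
  unfold ultraBracket
  rw [← map_add]
  congr 1
  ext x
  simp [gelfandShilovConj, h]

theorem ultraBracket_of_eq_smul {s r : ℝ} {ι : Type} [Fintype ι] [DecidableEq ι]
    (σ : ultraDistribution s r ι) {χ φ : gelfandShilov s r ι} {c : ℂ}
    (h : (χ : EuclideanSpace ℝ ι → ℂ) = c • (φ : EuclideanSpace ℝ ι → ℂ)) :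
    ultraBracket σ χ = (starRingEnd ℂ) c * ultraBracket σ φ := by
  unfold ultraBracket
  rw [← smul_eq_mul, ← map_smul]
  congr 1
  ext x
  simp [gelfandShilovConj, h]

theorem gelfandShilovConj_conj {s r : ℝ} {ι : Type} [Fintype ι] [DecidableEq ι]
    (φ : gelfandShilov s r ι) : gelfandShilovConj (gelfandShilovConj φ) = φ := by
  ext x
  simp [gelfandShilovConj]

theorem gelfandShilovConj_add {s r : ℝ} {ι : Type} [Fintype ι] [DecidableEq ι]
    (φ ψ : gelfandShilov s r ι) :
    (gelfandShilovConj (φ + ψ) : EuclideanSpace ℝ ι → ℂ) =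
      (gelfandShilovConj φ : EuclideanSpace ℝ ι → ℂ) + gelfandShilovConj ψ :=
  funext fun _ => map_add (starRingEnd ℂ) _ _

theorem gelfandShilovConj_smul {s r : ℝ} {ι : Type} [Fintype ι] [DecidableEq ι] (c : ℂ)
    (φ : gelfandShilov s r ι) :
    (gelfandShilovConj (c • φ) : EuclideanSpace ℝ ι → ℂ) =
      (starRingEnd ℂ) c • (gelfandShilovConj φ : EuclideanSpace ℝ ι → ℂ) :=
  funext fun _ => map_mul (starRingEnd ℂ) _ _

variable {d : ℕ} {p p' q q' : EuclideanSpace ℝ (Fin d) → ℂ}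

theorem crossWigner_add_left (hp : RapidDecay p) (hp' : RapidDecay p') (hq : RapidDecay q) :
    crossWigner (p + p') q = crossWigner p q + crossWigner p' q := by
  funext z
  refine Eq.trans ?_ (MeasureTheory.integral_add (integrable_wignerIntegrand hp hq z)
    (integrable_wignerIntegrand hp' hq z))
  refine MeasureTheory.integral_congr_ae (Filter.Eventually.of_forall fun t => ?_)
  simp only [Pi.add_apply]
  ring

theorem crossWigner_add_right (hp : RapidDecay p) (hq : RapidDecay q) (hq' : RapidDecay q') :
    crossWigner p (q + q') = crossWigner p q + crossWigner p q' := by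
  funext z
  refine Eq.trans ?_ (MeasureTheory.integral_add (integrable_wignerIntegrand hp hq z)
    (integrable_wignerIntegrand hp hq' z))
  refine MeasureTheory.integral_congr_ae (Filter.Eventually.of_forall fun t => ?_)
  simp only [Pi.add_apply, map_add]
  ring

theorem crossWigner_smul_left (c : ℂ) (p q : EuclideanSpace ℝ (Fin d) → ℂ) :
    crossWigner (c • p) q = c • crossWigner p q := by
  funext z
  refine Eq.trans ?_ (MeasureTheory.integral_const_mul c _)
  refine MeasureTheory.integral_congr_ae (Filter.Eventually.of_forall fun t => ?_)
  simp only [Pi.smul_apply, smul_eq_mul]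
  ring

theorem crossWigner_smul_right (c : ℂ) (p q : EuclideanSpace ℝ (Fin d) → ℂ) :
    crossWigner p (c • q) = (starRingEnd ℂ) c • crossWigner p q := by
  funext z
  refine Eq.trans ?_ (MeasureTheory.integral_const_mul _ _)
  refine MeasureTheory.integral_congr_ae (Filter.Eventually.of_forall fun t => ?_)
  simp only [Pi.smul_apply, smul_eq_mul, map_mul]
  ring

theorem rapidDecay_of_mem_gelfandShilov {s : ℝ} (hs : 1 / 2 ≤ s) {ι : Type} [Fintype ι]
    [DecidableEq ι] (φ : gelfandShilov s s ι) : RapidDecay (φ : EuclideanSpace ℝ ι → ℂ) := by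
  obtain ⟨_, _, _, h⟩ := exists_wordBound_of_mem_gelfandShilov hs φ.2
  exact h.rapidDecay

/-- The bilinear form `(f, φ) ↦ ⟨σ, W(conj φ, f)⟩`. -/
def weylForm {s : ℝ} (hs : 1 / 2 ≤ s) (σ : ultraDistribution s s (Fin d ⊕ Fin d)) :
    gelfandShilov s s (Fin d) →ₗ[ℂ] gelfandShilov s s (Fin d) →ₗ[ℂ] ℂ :=
  -- W(conj φ, f) is antilinear in both f and φ, and the bracket is antilinear in its test function,
  -- so the composite is linear in each.
  LinearMap.mk₂ ℂ
    (fun f φ => ultraBracket σ ⟨_, crossWigner_mem_gelfandShilov hs (gelfandShilovConj φ).2 f.2⟩)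
    (fun f f' φ => ultraBracket_of_eq_add σ
      (crossWigner_add_right (rapidDecay_of_mem_gelfandShilov hs _)
        (rapidDecay_of_mem_gelfandShilov hs f) (rapidDecay_of_mem_gelfandShilov hs f')))
    (fun c f φ => by
      have hmem := crossWigner_mem_gelfandShilov hs (gelfandShilovConj φ).2 f.2
      refine (ultraBracket_of_eq_smul σ (φ := ⟨_, hmem⟩) (c := (starRingEnd ℂ) c)
        (crossWigner_smul_right c _ _)).trans ?_
      rw [Complex.conj_conj, smul_eq_mul])
    (fun f φ φ' => by
      refine ultraBracket_of_eq_add σ (Eq.trans ?_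
        (crossWigner_add_left (rapidDecay_of_mem_gelfandShilov hs (gelfandShilovConj φ))
          (rapidDecay_of_mem_gelfandShilov hs (gelfandShilovConj φ'))
          (rapidDecay_of_mem_gelfandShilov hs f)))
      rw [← gelfandShilovConj_add])
    (fun c f φ => by
      have hmem := crossWigner_mem_gelfandShilov hs (gelfandShilovConj φ).2 f.2
      refine (ultraBracket_of_eq_smul σ (φ := ⟨_, hmem⟩) (c := (starRingEnd ℂ) c) (Eq.trans ?_
        (crossWigner_smul_left ((starRingEnd ℂ) c) _ _))).trans ?_
      · rw [← gelfandShilovConj_smul]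
      · rw [Complex.conj_conj, smul_eq_mul])

theorem GelfandShilovBound.conj {ι : Type} [Fintype ι] [DecidableEq ι] {s r A B M : ℝ}
    {φ : gelfandShilov s r ι}
    (h : GelfandShilovBound s r A B M (φ : EuclideanSpace ℝ ι → ℂ)) :
    GelfandShilovBound s r A B M (gelfandShilovConj φ : EuclideanSpace ℝ ι → ℂ) := by
  intro α β x
  refine le_of_eq_of_le ?_ (h α β x)
  exact congrArg _ (norm_partialDeriv_conj β _ x)

/-- For fixed f, the map φ ↦ W(conj φ, f) sends the normed space with parameters A, B boundedly into
a single one with parameters E, E, on which σ is bounded. This uses that the constants in the word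
estimates do not depend on φ. -/
theorem weylForm_mem_ultraDistribution {s : ℝ} (hs : 1 / 2 ≤ s)
    (σ : ultraDistribution s s (Fin d ⊕ Fin d)) (f : gelfandShilov s s (Fin d)) :
    weylForm hs σ f ∈ ultraDistribution s s (Fin d) := by
  intro A B hA hB
  obtain ⟨C, N, hC, hf⟩ := exists_wordBound_of_mem_gelfandShilov hs f.2
  obtain ⟨C', hC', hφ⟩ := exists_wordBound_of_gelfandShilovBound (ι := Fin d) hs A B hA hB
  obtain ⟨D, K, hD, hK, hW⟩ := exists_wordBound_crossWigner d (s := s) (C := max C C')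
    (by linarith) (hC.trans (le_max_left _ _))
  obtain ⟨E, hE, hE'⟩ := exists_gelfandShilovBound_of_wordBound (ι := Fin d ⊕ Fin d) (s := s)
    (by linarith) D hD
  obtain ⟨S, hS⟩ := σ.2 E E hE hE
  refine ⟨S * (K * N), fun φ M h => ?_⟩
  have h1 := (hφ _ M (gelfandShilovConj φ).2.1 h.conj).mono (by linarith) (le_max_right C C')
  have h2 := hW _ _ M N h1 (hf.mono (by linarith) (le_max_left C C'))
  have h3 : GelfandShilovBound s s E E (K * (M * N))
      ((⟨_, crossWigner_mem_gelfandShilov hs (gelfandShilovConj φ).2 f.2⟩ :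
        gelfandShilov s s (Fin d ⊕ Fin d)) : PhaseSpace d → ℂ) := hE' _ _ h2.nonneg h2
  refine (hS _ _ h3.conj).trans_eq ?_
  ring

/-- The Weyl operator with symbol `σ`. -/
def weylOperator {s : ℝ} (hs : 1 / 2 ≤ s) (σ : ultraDistribution s s (Fin d ⊕ Fin d)) :
    gelfandShilov s s (Fin d) →ₗ[ℂ] ultraDistribution s s (Fin d) :=
  LinearMap.codRestrict _ (weylForm hs σ) (weylForm_mem_ultraDistribution hs σ)

theorem isWeylOperator_weylOperator {s : ℝ} (hs : 1 / 2 ≤ s)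
    (σ : ultraDistribution s s (Fin d ⊕ Fin d)) : IsWeylOperator σ (weylOperator hs σ) := by
  intro f h
  refine ⟨crossWigner_mem_gelfandShilov hs h.2 f.2, ?_⟩
  change ultraBracket σ ⟨crossWigner (gelfandShilovConj (gelfandShilovConj h)) f, _⟩ = _
  simp only [gelfandShilovConj_conj]

/-- The value of a functional at φ is its bracket with conj φ, and the weak formula prescribes all
brackets. -/
theorem IsWeylOperator.unique {s : ℝ} {σ : ultraDistribution s s (Fin d ⊕ Fin d)}
    {T T' : gelfandShilov s s (Fin d) →ₗ[ℂ] ultraDistribution s s (Fin d)}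
    (hT : IsWeylOperator σ T) (hT' : IsWeylOperator σ T') : T = T' := by
  ext f φ
  obtain ⟨_, h⟩ := hT f (gelfandShilovConj φ)
  obtain ⟨_, h'⟩ := hT' f (gelfandShilovConj φ)
  have := h.trans h'.symm
  simpa only [ultraBracket, gelfandShilovConj_conj] using this

/-- The weak formula gives ⟨σ, W(π(w)g, π(z)g)⟩; covariance turns the test function into a
unimodular multiple of a shift of W(g,g), and the modulus removes the scalar. -/
theorem norm_ultraBracket_phaseShift {s : ℝ} {g : EuclideanSpace ℝ (Fin d) → ℂ}
    {σ : ultraDistribution s s (Fin d ⊕ Fin d)}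
    {T : gelfandShilov s s (Fin d) →ₗ[ℂ] ultraDistribution s s (Fin d)} (hT : IsWeylOperator σ T)
    (hπ : ∀ z : PhaseSpace d, phaseShift z g ∈ gelfandShilov s s (Fin d))
    (hΦ : ∀ u v : PhaseSpace d,
      timeFreqShift u v (crossWigner g g) ∈ gelfandShilov s s (Fin d ⊕ Fin d))
    (z w : PhaseSpace d) :
    ‖ultraBracket (T ⟨phaseShift z g, hπ z⟩) ⟨phaseShift w g, hπ w⟩‖ =
      ‖stft σ (crossWigner g g) hΦ ((1 / 2 : ℝ) • (z + w)) (phaseRotation d (w - z))‖ := by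
  obtain ⟨hW, h⟩ := hT ⟨phaseShift z g, hπ z⟩ ⟨phaseShift w g, hπ w⟩
  obtain ⟨c, hc, hcov⟩ := crossWigner_phaseShift g g w z
  rw [h, ultraBracket_of_eq_smul σ (φ := ⟨_, hΦ _ _⟩) hcov, norm_mul, RCLike.norm_conj, hc,
    one_mul, stft]

end WeylOperator

end

/-! ### The lemma -/

theorem mainTheorem4 (d : ℕ) (s : ℝ) (hs : 1 / 2 ≤ s)
    (g : EuclideanSpace ℝ (Fin d) → ℂ) (hg : g ∈ gelfandShilov s s (Fin d)) :
    crossWigner g g ∈ gelfandShilov s s (Fin d ⊕ Fin d) ∧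
    ∃ (hπ : ∀ z : PhaseSpace d, phaseShift z g ∈ gelfandShilov s s (Fin d))
      (hΦ : ∀ u v : PhaseSpace d,
        timeFreqShift u v (crossWigner g g) ∈ gelfandShilov s s (Fin d ⊕ Fin d)),
      ∀ σ : ultraDistribution s s (Fin d ⊕ Fin d),
        (∃! T : gelfandShilov s s (Fin d) →ₗ[ℂ] ultraDistribution s s (Fin d),
          IsWeylOperator σ T) ∧
        ∀ T : gelfandShilov s s (Fin d) →ₗ[ℂ] ultraDistribution s s (Fin d),
          IsWeylOperator σ T →
          (∀ z w : PhaseSpace d,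
            ‖ultraBracket (T ⟨phaseShift z g, hπ z⟩) ⟨phaseShift w g, hπ w⟩‖ =
              ‖stft σ (crossWigner g g) hΦ ((1 / 2 : ℝ) • (z + w)) (phaseRotation d (w - z))‖) ∧
          ∀ u v : PhaseSpace d,
            ‖stft σ (crossWigner g g) hΦ u v‖ =
              ‖ultraBracket
                (T ⟨phaseShift (u - (1 / 2 : ℝ) • (phaseRotation d).symm v) g, hπ _⟩)
                ⟨phaseShift (u + (1 / 2 : ℝ) • (phaseRotation d).symm v) g, hπ _⟩‖ := by
  have hW := crossWigner_mem_gelfandShilov hs hg hg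
  have hπ : ∀ z : PhaseSpace d, phaseShift z g ∈ gelfandShilov s s (Fin d) := fun z =>
    timeFreqShift_mem_gelfandShilov hs hg _ _
  have hΦ : ∀ u v : PhaseSpace d,
      timeFreqShift u v (crossWigner g g) ∈ gelfandShilov s s (Fin d ⊕ Fin d) :=
    timeFreqShift_mem_gelfandShilov hs hW
  refine ⟨hW, hπ, hΦ, fun σ => ⟨⟨weylOperator hs σ, isWeylOperator_weylOperator hs σ,
    fun T hT => hT.unique (isWeylOperator_weylOperator hs σ)⟩, fun T hT =>
    ⟨norm_ultraBracket_phaseShift hT hπ hΦ, fun u v => ?_⟩⟩⟩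
  rw [norm_ultraBracket_phaseShift hT hπ hΦ]
  -- The points u ∓ a/2 have midpoint u and difference a, and j(a) = v, so the second formula is the
  -- first one at these points.
  set a := (phaseRotation d).symm v with ha
  have h1 : (1 / 2 : ℝ) • (u - (1 / 2 : ℝ) • a + (u + (1 / 2 : ℝ) • a)) = u := by module
  have h2 : u + (1 / 2 : ℝ) • a - (u - (1 / 2 : ℝ) • a) = a := by module
  rw [h1, h2, ha, LinearEquiv.apply_symm_apply]
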